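/- Let $p$ be a prime, let $e,n\ge 1$, $r=2en$, $q=p^r$, let $s\ge 1$ be a divisor of $p^e+1$ (hence of $q-1$), and let $0\le h<s$, $m\ge 2$, $t\mid m$. Let $\gamma$ be a primitive element of $\mathbb F_{q^m}$, let $\gamma_t$ be the norm of $\gamma$ from $\mathbb F_{q^m}$ to $\mathbb F_{q^t}$, and let $g=\gamma_1$ be its norm to $\mathbb F_q$. For $a\in\mathbb F_q$ let $N_t$ be the number of $x\in\mathbb F_{q^t}$ with $\mathrm{Tr}_{\mathbb F_{q^m}/\mathbb F_q}(x)=a$ and $\mathrm{N}_{\mathbb F_{q^m}/\mathbb F_q}(x)\in g^h\langle g^s\rangle$. Put $d=\gcd(m/t,s)$, $l=\gcd(t,s/d)$, $u=s/(dl)$ and $t_0=(q^t-1)/(q-1)$, and assume that $p\nmid m/t$ and $d\mid h$. For a positive divisor $N$ of $p^e+1$ put $k_N=N/2$ if $p>2$ and both $nt$ and $(p^e+1)/N$ are odd, and $k_N=0$ otherwise. Let $i_0$ be the solution of $\frac{m}{dt}\,i_0\equiv\frac hd \pmod{s/d}$ with $0\le i_0<s/d$. If $a\neq 0$, put $a_0=-\frac{m}{ta}\in\mathbb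 F_q^*$, let $\operatorname{ind}a_0$ be an integer $\iota\ge 0$ with $\gamma_t^{\iota}=a_0$, and put $D=k_{s/d}-i_0-\operatorname{ind}a_0$; if moreover $l\mid D$, let $j_0$ be the solution of $\frac{t_0}{l}\,j_0\equiv\frac Dl\pmod u$ with $0\le j_0<u$. Theorem. If $a=0$, then $$N_t=\begin{cases}\frac ds\bigl(q^{t-1}-1+(-1)^{nt}(q-1)\sqrt{q^{t-2}}\bigr)&\text{if } l>1 \text{ and } i_0\not\equiv k_l \pmod l,\\[2pt] \frac ds\bigl(q^{t-1}-1-(-1)^{nt}(q-1)(l-1)\sqrt{q^{t-2}}\bigr)&\text{if } l=1, \text{ or } l>1 \text{ and } i_0\equiv k_l \pmod l.\end{cases}$$ If $a\ne 0$, then $$N_t=\begin{cases}\frac ds\bigl(q^{t-1}-(-1)^{nt}\sqrt{q^{t-2}}\bigr)&\text{if } l\nmid D,\\[2pt] \frac ds\bigl(q^{t-1}-(-1)^{nt}\bigl(((-1)^n\sqrt q-1)l+1\bigr)\sqrt{q^{t-2}}\bigr)&\text{if } l\mid D,\ u>1 \text{ and } j_0\not\equiv k_u\pmod u,\\[2pt]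 \frac ds\bigl(q^{t-1}-(-1)^{nt}\bigl(((-1)^{n-1}(u-1)\sqrt q-1)l+1\bigr)\sqrt{q^{t-2}}\bigr)&\text{if } l\mid D, \text{ and } u=1 \text{ or } (u>1 \text{ and } j_0\equiv k_u\pmod u).\end{cases}$$ In particular, $N_t=\frac ds(q^{t-1}-1)$ if $a=0$ and $l=1$, and $N_t=q^{t-1}$ if $a\ne0$ and $d=s$. -/

import Mathlib

/-- For a unit `γ` of a field `K ⊇ L`, its norm `Norm_{K/L}(γ)`, as a unit of `L`.
For `K = 𝔽_{q^m}` and `γ` a primitive element this is the primitive element `γ_t` of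
`L = 𝔽_{q^t}`, respectively `g` of `L = 𝔽_q`. -/
noncomputable def unitNorm (L : Type*) {K : Type*} [Field L] [Field K] [Algebra L K]
    (γ : Kˣ) : Lˣ :=
  Units.map (Algebra.norm L : K →* L) γ

/-- The set `S_t(a, s, h)` of the `x ∈ E` (`E = 𝔽_{q^t}`, an intermediate field of `K = 𝔽_{q^m}`
over `F = 𝔽_q`) with `Tr_{K/F}(x) = a` and `Norm_{K/F}(x) ∈ g^h ⟨g^s⟩`,
where `g = Norm_{K/F}(γ)`. -/
def traceNormSet {F K : Type*} [Field F] [Field K] [Algebra F K]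
    (E : IntermediateField F K) (γ : Kˣ) (a : F) (s h : ℕ) : Set E :=
  {x | Algebra.trace F K (x : K) = a ∧
    ∃ y ∈ Subgroup.zpowers (unitNorm F γ ^ s),
      Algebra.norm F (x : K) = ((unitNorm F γ ^ h * y : Fˣ) : F)}

/-- The number `k_N`, for a divisor `N` of `p^e + 1`: it is `N / 2` if `p > 2` and both `n t` and
`(p^e + 1) / N` are odd (then `N` is even), and `0` otherwise. -/
def kConst (p e n t N : ℕ) : ℕ :=
  if 2 < p ∧ ¬ 2 ∣ n * t ∧ ¬ 2 ∣ (p ^ e + 1) / N then N / 2 else 0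

/-!
By orthogonality of additive characters, counting the `y` with `Tr_{E/F}(c yᴺ) = b` amounts to
evaluating Weil sums `∑ₓ ψ(a c xᴺ)` with `a ∈ Fˣ`. For `N = p^e + 1`, expanding `(z + y)^N` shows
that such a sum has absolute value `√|E|`, unless its coefficient lies in one exceptional coset of
the `N`-th powers. It is real and congruent to `1` modulo `p^e + 1`, and `-p^e ≡ 1`, so its sign is
determined; since all the Weil sums add up to `0`, the value on the exceptional coset follows.
Averaging over cosets gives the Weil sums for every divisor `N` of `p^e + 1`. As `Fˣ` is generated
by `γ_t^{t₀}`, congruences modulo `l` and `u` decide for which `a` the coefficient `a c` is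
exceptional.
-/

open Finset ComplexConjugate

section CyclicGroup

theorem mem_zpowers_generator_pow_iff {G : Type*} [Group G] {γ : G}
    (hγ : ∀ x, x ∈ Subgroup.zpowers γ) {N : ℕ} {y : G} :
    y ∈ Subgroup.zpowers (γ ^ N) ↔ ∃ x, x ^ N = y := by
  constructor
  · rintro ⟨w, rfl⟩
    exact ⟨γ ^ w, by simp only [← zpow_natCast, zpow_comm]⟩
  · rintro ⟨x, rfl⟩
    obtain ⟨w, rfl⟩ := hγ x
    exact ⟨w, by simp only [← zpow_natCast, zpow_comm]⟩

variable {G : Type*} [CommGroup G] [Fintype G] {N M : ℕ}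

theorem exists_zpow_mul_pow_eq_zpow_iff {γ : G} (hγ : ∀ x, x ∈ Subgroup.zpowers γ)
    (hN : N ∣ Fintype.card G) (D z : ℤ) :
    (∃ y, γ ^ D * y ^ N = γ ^ z) ↔ z ≡ D [ZMOD N] := by
  have hNγ : (N : ℤ) ∣ orderOf γ := by
    rw [orderOf_eq_card_of_forall_mem_zpowers hγ, Nat.card_eq_fintype_card]
    exact_mod_cast hN
  constructor
  · rintro ⟨y, hy⟩
    obtain ⟨w, rfl⟩ := hγ y
    simp only [← zpow_natCast, ← zpow_mul, ← zpow_add] at hy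
    have hmod := (zpow_eq_zpow_iff_modEq.mp hy).of_dvd hNγ
    exact hmod.symm.trans (by simp [Int.modEq_iff_dvd])
  · intro hmod
    obtain ⟨w, hw⟩ := hmod.symm.dvd
    refine ⟨γ ^ w, ?_⟩
    rw [← zpow_natCast, ← zpow_mul, ← zpow_add]
    congr 1
    linarith

variable [IsCyclic G]

theorem exists_pow_eq_iff_pow_eq_one (h : N * M = Fintype.card G) (x : G) :
    (∃ y, y ^ N = x) ↔ x ^ M = 1 := by
  have hcard : Nat.card G = N * M := by rw [Nat.card_eq_fintype_card, h]
  have hN : 0 < N := Nat.pos_of_mul_pos_right (h ▸ Fintype.card_pos : 0 < N * M)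
  have hle : (powMonoidHom N : G →* G).range ≤ (powMonoidHom M).ker := by
    rintro _ ⟨y, rfl⟩
    simp only [MonoidHom.mem_ker, powMonoidHom_apply, ← pow_mul, h, pow_card_eq_one]
  have heq : (powMonoidHom N : G →* G).range = (powMonoidHom M).ker :=
    Subgroup.eq_of_le_of_card_ge hle (by
      rw [IsCyclic.card_powMonoidHom_range, IsCyclic.card_powMonoidHom_ker, hcard,
        Nat.gcd_mul_left_left, Nat.gcd_mul_right_left, Nat.mul_div_cancel_left M hN])
  exact SetLike.ext_iff.mp heq x

variable [DecidableEq G]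

theorem card_filter_pow_eq (h : N * M = Fintype.card G) (y : G) :
    #{x : G | x ^ M = y} = if y ^ N = 1 then M else 0 := by
  have hroots := exists_pow_eq_iff_pow_eq_one ((mul_comm M N).trans h) y
  split_ifs with hy
  · have hfiber : #{x : G | x ^ M = y} = #{x : G | x ^ M = 1} :=
      MonoidHom.card_fiber_eq_of_mem_range (powMonoidHom M) (hroots.mpr hy) ⟨1, map_one _⟩
    have hker : Nat.card {x : G // x ^ M = 1} = (Nat.card G).gcd M :=
      IsCyclic.card_powMonoidHom_ker G M
    rw [Nat.card_eq_fintype_card, Nat.card_eq_fintype_card, ← h, Nat.gcd_mul_left_left] at hker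
    rw [hfiber, ← Fintype.card_subtype, hker]
  · rw [Finset.card_eq_zero, Finset.filter_eq_empty_iff]
    exact fun x _ hx => hy (hroots.mp ⟨x, hx⟩)

theorem sum_comp_pow {R : Type*} [AddCommMonoid R] (h : N * M = Fintype.card G) (f : G → R) :
    ∑ y, f (y ^ N) = N • ∑ x with x ^ M = 1, f x := by
  rw [← Finset.sum_fiberwise' _ (fun y : G => y ^ N), Finset.sum_filter, Finset.smul_sum]
  refine Finset.sum_congr rfl fun x _ => ?_
  rw [Finset.sum_const, card_filter_pow_eq ((mul_comm M N).trans h)]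
  split_ifs <;> simp

end CyclicGroup

section CyclicCosets

theorem mul_left_modEq_iff_of_coprime {c u : ℕ} (h : c.Coprime u) (a b : ℤ) :
    c * a ≡ c * b [ZMOD u] ↔ a ≡ b [ZMOD u] := by
  refine ⟨fun hab => ?_, fun hab => hab.mul_left _⟩
  rw [Int.modEq_iff_dvd, ← mul_sub] at hab
  exact Int.modEq_iff_dvd.mpr ((Nat.isCoprime_iff_coprime.mpr h).symm.dvd_of_dvd_mul_left hab)

theorem exists_natCast_mul_modEq {c u : ℕ} (h : c.Coprime u) (hu : u ≠ 0) (D : ℤ) :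
    ∃ j : ℕ, c * j ≡ D [ZMOD u] := by
  obtain ⟨y, hy⟩ := Int.mod_coprime h
  have hu' : (u : ℤ) ≠ 0 := mod_cast hu
  refine ⟨(y * D % u).toNat, ?_⟩
  rw [Int.toNat_of_nonneg (Int.emod_nonneg _ hu')]
  calc c * (y * D % u) ≡ c * (y * D) [ZMOD u] := (Int.mod_modEq _ _).mul_left _
    _ = c * y * D := (mul_assoc _ _ _).symm
    _ ≡ 1 * D [ZMOD u] := hy.mul_right D
    _ = D := one_mul D

variable {G H : Type*} [CommGroup G] [CommGroup H] [Fintype H] {γG : G} {γH : H} {φ : G →* H}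

theorem dvd_of_zpow_mul_pow_eq_map (hγG : ∀ x, x ∈ Subgroup.zpowers γG)
    (hγH : ∀ x, x ∈ Subgroup.zpowers γH) {l t₀ N : ℕ} (hφ : φ γG = γH ^ t₀)
    (hlt₀ : l ∣ t₀) (hlN : l ∣ N) (hN : N ∣ Fintype.card H) {D : ℤ} {a : G}
    (h : ∃ y, γH ^ D * y ^ N = φ a) : (l : ℤ) ∣ D := by
  obtain ⟨z, rfl⟩ := hγG a
  simp only [map_zpow, hφ, ← zpow_natCast γH, ← zpow_mul,
    exists_zpow_mul_pow_eq_zpow_iff hγH hN] at h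
  have hmod : t₀ * z ≡ D [ZMOD l] := h.of_dvd (Int.natCast_dvd_natCast.mpr hlN)
  exact hmod.dvd_iff.mp ((Int.natCast_dvd_natCast.mpr hlt₀).mul_right z)

variable [Fintype G] {l u t₁ : ℕ}

theorem exists_zpow_mul_pow_eq_map_iff (hγG : ∀ x, x ∈ Subgroup.zpowers γG)
    (hγH : ∀ x, x ∈ Subgroup.zpowers γH) (hφ : φ γG = γH ^ (l * t₁)) (hl : l ≠ 0)
    (ht₁ : t₁.Coprime u) (hu : u ∣ Fintype.card G) (hN : l * u ∣ Fintype.card H) {D j : ℤ}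
    (hj : t₁ * j ≡ D [ZMOD u]) (a : G) :
    (∃ y, γH ^ (l * D) * y ^ (l * u) = φ a) ↔ ∃ x, γG ^ j * x ^ u = a := by
  obtain ⟨z, rfl⟩ := hγG a
  simp only [map_zpow, hφ, ← zpow_natCast γH, ← zpow_mul, exists_zpow_mul_pow_eq_zpow_iff hγH hN,
    exists_zpow_mul_pow_eq_zpow_iff hγG hu]
  push_cast
  rw [mul_assoc, Int.ModEq.mul_left_cancel_iff' (mod_cast hl),
    ← mul_left_modEq_iff_of_coprime ht₁ z j]
  exact ⟨fun h => h.trans hj.symm, fun h => h.trans hj⟩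

variable [IsCyclic G] {R : Type*} [AddCommMonoid R]

theorem smul_sum_filter_exists_mul_pow (hu : u ∣ Fintype.card G) (g : G) (f : G → R)
    [DecidablePred fun a => ∃ x, g * x ^ u = a] :
    u • ∑ a with ∃ x, g * x ^ u = a, f a = ∑ x, f (g * x ^ u) := by
  classical
  obtain ⟨M, hM⟩ := hu
  rw [sum_comp_pow hM.symm fun x => f (g * x)]
  congr 1
  refine (Finset.sum_equiv (Equiv.mulLeft g) (fun x => ?_) fun x _ => rfl).symm
  simp [exists_pow_eq_iff_pow_eq_one hM.symm]

theorem smul_sum_filter_zpow_mul_pow_eq_map (hγG : ∀ x, x ∈ Subgroup.zpowers γG)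
    (hγH : ∀ x, x ∈ Subgroup.zpowers γH) (hφ : φ γG = γH ^ (l * t₁)) (hl : l ≠ 0)
    (ht₁ : t₁.Coprime u) (hu : u ∣ Fintype.card G) (hN : l * u ∣ Fintype.card H) {D j : ℤ}
    (hj : t₁ * j ≡ D [ZMOD u]) (f : G → R)
    [DecidablePred fun a => ∃ y, γH ^ (l * D) * y ^ (l * u) = φ a] :
    (l * u) • ∑ a with ∃ y, γH ^ (l * D) * y ^ (l * u) = φ a, f a
      = l • ∑ x, f (γG ^ j * x ^ u) := by
  classical
  simp only [exists_zpow_mul_pow_eq_map_iff hγG hγH hφ hl ht₁ hu hN hj, mul_smul,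
    smul_sum_filter_exists_mul_pow hu]

end CyclicCosets

section MonomialSum

variable {L : Type*} [Field L] [Fintype L]

theorem sum_eq_apply_zero_add_sum_units [DecidableEq L] {R : Type*} [AddCommMonoid R] (f : L → R) :
    ∑ x, f x = f 0 + ∑ x : Lˣ, f x := by
  rw [Fintype.sum_eq_add_sum_subtype_ne f 0, ← unitsEquivNeZero.sum_comp]
  rfl

theorem sum_addChar_mul_eq_zero {ψ : AddChar L ℂ} (hψ : ψ ≠ 1) {a : L} (ha : a ≠ 0) :
    ∑ x, ψ (a * x) = 0 :=
  AddChar.sum_eq_zero_of_ne_one (AddChar.IsPrimitive.of_ne_one hψ ha)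

theorem sum_units_addChar_mul [DecidableEq L] {ψ : AddChar L ℂ} (hψ : ψ ≠ 1) {a : L} (ha : a ≠ 0) :
    ∑ x : Lˣ, ψ (a * x) = -1 := by
  have hsum := sum_addChar_mul_eq_zero hψ ha
  rw [sum_eq_apply_zero_add_sum_units, mul_zero, AddChar.map_zero_eq_one] at hsum
  linear_combination hsum

/-- The Weil sum `∑ₓ ψ(c xᴺ)` of a monomial over the finite field `L`, the term `x = 0`
included. -/
noncomputable def monomialSum (ψ : AddChar L ℂ) (N : ℕ) (c : L) : ℂ :=
  ∑ x, ψ (c * x ^ N)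

theorem monomialSum_mul_pow (ψ : AddChar L ℂ) (N : ℕ) (c : L) (y : Lˣ) :
    monomialSum ψ N (c * (y : L) ^ N) = monomialSum ψ N c := by
  refine (Finset.sum_congr rfl fun x _ => ?_).trans
    (Equiv.sum_comp y.mulLeft fun x => ψ (c * x ^ N))
  rw [Units.mulLeft_apply, mul_pow, mul_assoc]

theorem conj_monomialSum (ψ : AddChar L ℂ) {N : ℕ} (c : L) (h : ∃ y : Lˣ, y ^ N = -1) :
    conj (monomialSum ψ N c) = monomialSum ψ N c := by
  obtain ⟨y, hy⟩ := h
  have hneg : (y : L) ^ N = -1 := by simpa using congrArg Units.val hy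
  conv_rhs => rw [← monomialSum_mul_pow ψ N c y, hneg]
  simp only [monomialSum, map_sum, ← AddChar.map_neg_eq_conj, mul_neg_one, neg_mul]

variable [DecidableEq L] {ψ : AddChar L ℂ} {N M : ℕ}

theorem monomialSum_eq_one_add_sum_units (hN : N ≠ 0) (ψ : AddChar L ℂ) (c : L) :
    monomialSum ψ N c = 1 + ∑ x : Lˣ, ψ (c * (x : L) ^ N) := by
  rw [monomialSum, sum_eq_apply_zero_add_sum_units, zero_pow hN, mul_zero,
    AddChar.map_zero_eq_one]

theorem exists_isIntegral_monomialSum_eq (ψ : AddChar L ℂ) (hN : N ∣ Fintype.card Lˣ) (c : L) :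
    ∃ η : ℂ, IsIntegral ℤ η ∧ monomialSum ψ N c = 1 + N * η := by
  obtain ⟨M, hM⟩ := hN
  have hN : N ≠ 0 := by rintro rfl; simp at hM
  refine ⟨∑ x : Lˣ with x ^ M = 1, ψ (c * x), IsIntegral.sum _ fun x _ => ?_, ?_⟩
  · exact IsIntegral.of_pow (Fintype.card_pos (α := L)) <| by
      rw [← AddChar.map_nsmul_eq_pow, card_nsmul_eq_zero, AddChar.map_zero_eq_one]
      exact isIntegral_one
  · rw [monomialSum_eq_one_add_sum_units hN, ← nsmul_eq_mul,
      ← sum_comp_pow hM.symm fun x : Lˣ => ψ (c * x)]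
    simp only [Units.val_pow_eq_pow_val]

theorem sum_units_monomialSum (hψ : ψ ≠ 1) (hN : N ≠ 0) : ∑ c : Lˣ, monomialSum ψ N c = 0 := by
  have hinner (x : Lˣ) : ∑ c : Lˣ, ψ (c * (x : L) ^ N) = -1 := by
    simp only [mul_comm _ ((x : L) ^ N)]
    exact sum_units_addChar_mul hψ (pow_ne_zero N x.ne_zero)
  simp only [monomialSum_eq_one_add_sum_units hN, Finset.sum_add_distrib]
  rw [Finset.sum_comm]
  simp [hinner]

theorem sum_units_monomialSum_mul_pow (hN : N ≠ 0) (hM : M ≠ 0) (ψ : AddChar L ℂ) (c : L) :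
    ∑ y : Lˣ, monomialSum ψ (N * M) (c * (y : L) ^ N) = Fintype.card Lˣ * monomialSum ψ N c := by
  have hinner (x : Lˣ) : ∑ y : Lˣ, ψ (c * (y : L) ^ N * (x : L) ^ (N * M))
      = ∑ y : Lˣ, ψ (c * (y : L) ^ N) := by
    rw [← Equiv.sum_comp (Equiv.mulRight (x ^ M)) fun y : Lˣ => ψ (c * (y : L) ^ N)]
    refine Finset.sum_congr rfl fun y _ => ?_
    rw [Equiv.coe_mulRight, Units.val_mul, Units.val_pow_eq_pow_val, mul_pow, ← pow_mul,
      mul_comm M N, mul_assoc]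
  simp only [monomialSum_eq_one_add_sum_units hN,
    monomialSum_eq_one_add_sum_units (mul_ne_zero hN hM), Finset.sum_add_distrib]
  rw [Finset.sum_comm, Finset.sum_congr rfl fun x _ => hinner x]
  simp only [Finset.sum_const, Finset.card_univ, nsmul_eq_mul, mul_one]
  ring

end MonomialSum

section Semiprimitive

theorem dvd_of_intCast_eq_mul_isIntegral {N : ℕ} {z : ℤ} {η : ℂ} (hη : IsIntegral ℤ η)
    (h : (z : ℂ) = N * η) : (N : ℤ) ∣ z := by
  obtain rfl | hN := eq_or_ne N 0
  · simpa using h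
  obtain ⟨w, rfl⟩ := hη.exists_int_iff_exists_rat.mp ⟨z / N, by
    push_cast
    rw [h, mul_div_cancel_left₀ η (Nat.cast_ne_zero.mpr hN)]⟩
  exact ⟨w, by exact_mod_cast h⟩

theorem eq_neg_pow_of_sq_eq {P k : ℕ} (hP : 2 ≤ P) {T η : ℂ} (hη : IsIntegral ℤ η)
    (hT : T = 1 + (P + 1 : ℕ) * η) (hsq : T ^ 2 = (P : ℂ) ^ (2 * k)) : T = (-P) ^ k := by
  have hmod : (-P : ℤ) ^ k ≡ 1 [ZMOD (P + 1 : ℕ)] := by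
    simpa using Int.ModEq.pow k (show (-P : ℤ) ≡ 1 [ZMOD (P + 1 : ℕ)] from
      Int.modEq_iff_dvd.mpr ⟨1, by push_cast; ring⟩)
  have hroots : T = (-P) ^ k ∨ T = -(-P) ^ k :=
    sq_eq_sq_iff_eq_or_eq_neg.mp (by rw [hsq, ← pow_mul, mul_comm k, (even_two_mul k).neg_pow])
  refine hroots.resolve_right fun hneg => ?_
  have hdvd : ((P + 1 : ℕ) : ℤ) ∣ -(-P) ^ k - 1 :=
    dvd_of_intCast_eq_mul_isIntegral hη (by push_cast at hT ⊢; linear_combination hT - hneg)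
  have htwo : ((P + 1 : ℕ) : ℤ) ∣ 2 := by
    rw [show (2 : ℤ) = (1 - (-P) ^ k) - (-(-P) ^ k - 1) by ring]
    exact dvd_sub hmod.dvd hdvd
  have hle := Int.le_of_dvd two_pos htwo
  omega

theorem addChar_pow_pow_eq {R : Type*} [Semiring R] {p : ℕ} {ψ : AddChar R ℂ}
    (hψ : ∀ x, ψ (x ^ p) = ψ x) (e : ℕ) (x : R) : ψ (x ^ p ^ e) = ψ x := by
  induction e with
  | zero => simp
  | succ e ih => rw [pow_succ, pow_mul, hψ, ih]

theorem neg_one_units_pow_char_pow (R : Type*) [CommRing R] (p e : ℕ) [Fact p.Prime] [CharP R p] :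
    (-1 : Rˣ) ^ p ^ e = -1 :=
  Units.ext (by simpa using neg_one_pow_char_pow (R := R) (p := p) (n := e))

variable {L : Type*} [Field L] [Fintype L] {ψ : AddChar L ℂ}

theorem sum_addChar_linearized_eq_zero {p : ℕ} [Fact p.Prime] [CharP L p] (e : ℕ)
    (hψ : ψ ≠ 1) (hψp : ∀ x, ψ (x ^ p) = ψ x) {c z : L}
    (hcz : c ^ p ^ e * (z ^ p ^ e) ^ p ^ e + c * z ≠ 0) :
    ∑ y, ψ (c * (z ^ p ^ e * y + z * y ^ p ^ e)) = 0 := by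
  have hfrob : Function.Bijective fun y : L => y ^ p ^ e :=
    Finite.injective_iff_bijective.mp (iterateFrobenius L p e).injective
  have hterm (y : L) : ψ (c * (z ^ p ^ e * y + z * y ^ p ^ e))
      = ψ ((c ^ p ^ e * (z ^ p ^ e) ^ p ^ e + c * z) * y ^ p ^ e) := by
    rw [mul_add, AddChar.map_add_eq_mul, ← addChar_pow_pow_eq hψp e (c * (z ^ p ^ e * y)),
      ← AddChar.map_add_eq_mul]
    congr 1
    ring
  simp only [hterm]
  rw [hfrob.sum_comp fun y => ψ (_ * y), sum_addChar_mul_eq_zero hψ hcz]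

theorem monomialSum_mul_conj {p e : ℕ} [Fact p.Prime] [CharP L p]
    (hψ : ψ ≠ 1) (hψp : ∀ x, ψ (x ^ p) = ψ x) {c : L}
    (hc : ∀ z ≠ 0, c ^ p ^ e * (z ^ p ^ e) ^ p ^ e + c * z ≠ 0) :
    monomialSum ψ (p ^ e + 1) c * conj (monomialSum ψ (p ^ e + 1) c) = Fintype.card L := by
  have hterm (z y : L) : ψ (c * (z + y) ^ (p ^ e + 1)) * conj (ψ (c * y ^ (p ^ e + 1)))
      = ψ (c * z ^ (p ^ e + 1)) * ψ (c * (z ^ p ^ e * y + z * y ^ p ^ e)) := by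
    rw [← AddChar.map_neg_eq_conj, ← AddChar.map_add_eq_mul, ← AddChar.map_add_eq_mul,
      pow_succ (z + y), add_pow_char_pow]
    congr 1
    ring
  have hp0 : p ^ e ≠ 0 := (Nat.pow_pos (Fact.out : p.Prime).pos).ne'
  calc monomialSum ψ (p ^ e + 1) c * conj (monomialSum ψ (p ^ e + 1) c)
      = ∑ y, ∑ z, ψ (c * (z + y) ^ (p ^ e + 1)) * conj (ψ (c * y ^ (p ^ e + 1))) := by
        rw [monomialSum, map_sum, Finset.sum_mul_sum, Finset.sum_comm]
        exact Finset.sum_congr rfl fun y _ => (Equiv.sum_comp (Equiv.addRight y) _).symm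
    _ = ∑ z, ψ (c * z ^ (p ^ e + 1)) * ∑ y, ψ (c * (z ^ p ^ e * y + z * y ^ p ^ e)) := by
        simp only [hterm, Finset.mul_sum]
        exact Finset.sum_comm
    _ = ψ (c * 0 ^ (p ^ e + 1)) * ∑ y, ψ (c * (0 ^ p ^ e * y + 0 * y ^ p ^ e)) :=
        Finset.sum_eq_single 0 (fun z _ hz => by
          rw [sum_addChar_linearized_eq_zero e hψ hψp (hc z hz), mul_zero]) (by simp)
    _ = Fintype.card L := by simp [zero_pow hp0]

theorem succ_mul_eq_card_units [DecidableEq L] {P k : ℕ} (hL : Fintype.card L = P ^ (2 * k)) :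
    (P + 1) * ((P - 1) * ∑ i ∈ range k, (P ^ 2) ^ i) = Fintype.card Lˣ := by
  have hP : 1 ≤ P ^ 2 := by
    refine Nat.one_le_pow _ _ (Nat.pos_of_ne_zero ?_)
    rintro rfl
    have := Fintype.one_lt_card (α := L)
    cases k <;> simp_all
  rw [← mul_assoc, ← Nat.sq_sub_sq, one_pow, mul_comm, geom_sum_mul_of_one_le hP,
    Fintype.card_units, hL, pow_mul]

theorem succ_dvd_card_units [DecidableEq L] {P k : ℕ} (hL : Fintype.card L = P ^ (2 * k)) :
    P + 1 ∣ Fintype.card Lˣ :=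
  Dvd.intro _ (succ_mul_eq_card_units hL)

theorem neg_one_units_pow_geom_sum (R : Type*) [CommRing R] (p e k : ℕ) [Fact p.Prime] [CharP R p] :
    (-1 : Rˣ) ^ ∑ i ∈ range k, ((p ^ e) ^ 2) ^ i = (-1) ^ k := by
  rw [← Finset.prod_pow_eq_pow_sum]
  simp only [← pow_mul, neg_one_units_pow_char_pow, Finset.prod_const, Finset.card_range]

theorem linearized_ne_zero [DecidableEq L] {p e k : ℕ} [Fact p.Prime] [CharP L p] {M : ℕ}
    (hM : (p ^ e + 1) * M = Fintype.card Lˣ) (hL : Fintype.card L = (p ^ e) ^ (2 * k)) {c : Lˣ}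
    (hc : c ^ M ≠ (-1) ^ k) {z : L} (hz : z ≠ 0) :
    (c : L) ^ p ^ e * (z ^ p ^ e) ^ p ^ e + c * z ≠ 0 := by
  intro h0
  set w : Lˣ := c * Units.mk0 z hz ^ (p ^ e + 1) with hw
  have hpos : 1 ≤ p ^ e := Nat.pow_pos (Fact.out : p.Prime).pos
  have hwP : w ^ p ^ e = -w := Units.ext <| by
    simp only [hw, Units.val_pow_eq_pow_val, Units.val_mul, Units.val_mk0, Units.val_neg]
    linear_combination z ^ p ^ e * h0
  have hroot : w ^ (p ^ e - 1) = -1 := by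
    rw [← mul_left_inj w, ← pow_succ, Nat.sub_add_cancel hpos, hwP, neg_one_mul]
  have hcw : c ^ M = w ^ M := by
    rw [hw, mul_pow, ← pow_mul, hM, pow_card_eq_one, mul_one]
  have hM' : M = (p ^ e - 1) * ∑ i ∈ range k, ((p ^ e) ^ 2) ^ i :=
    Nat.eq_of_mul_eq_mul_left (Nat.succ_pos _) (hM.trans (succ_mul_eq_card_units hL).symm)
  exact hc (by rw [hcw, hM', pow_mul, hroot, neg_one_units_pow_geom_sum])

variable {p e k : ℕ} [Fact p.Prime] [CharP L p]

theorem exists_pow_succ_eq_neg_one (hL : Fintype.card L = (p ^ e) ^ (2 * k)) :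
    ∃ y : Lˣ, y ^ (p ^ e + 1) = -1 := by
  classical
  have hpos : 1 ≤ p ^ e := Nat.pow_pos (Fact.out : p.Prime).pos
  have hpred : (-1 : Lˣ) ^ (p ^ e - 1) = 1 := by
    rw [← mul_left_inj (-1 : Lˣ), ← pow_succ, Nat.sub_add_cancel hpos,
      neg_one_units_pow_char_pow, one_mul]
  exact (exists_pow_eq_iff_pow_eq_one (succ_mul_eq_card_units hL) _).mpr
    (by rw [pow_mul, hpred, one_pow])

variable [DecidableEq L] {M : ℕ}

theorem monomialSum_succ_of_ne (hL : Fintype.card L = (p ^ e) ^ (2 * k)) (hψ : ψ ≠ 1)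
    (hψp : ∀ x, ψ (x ^ p) = ψ x) (hM : (p ^ e + 1) * M = Fintype.card Lˣ) {c : Lˣ}
    (hc : c ^ M ≠ (-1) ^ k) :
    monomialSum ψ (p ^ e + 1) (c : L) = (-(p ^ e : ℕ)) ^ k := by
  have hP : 2 ≤ p ^ e := by
    have hpos : 1 ≤ p ^ e := Nat.pow_pos (Fact.out : p.Prime).pos
    refine hpos.lt_of_ne' fun h1 => ?_
    exact (Fintype.one_lt_card (α := L)).ne' (by rw [hL, h1, one_pow])
  obtain ⟨η, hη, hT⟩ := exists_isIntegral_monomialSum_eq ψ (Dvd.intro M hM) (c : L)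
  refine eq_neg_pow_of_sq_eq hP hη hT ?_
  have hnorm := monomialSum_mul_conj hψ hψp fun z => linearized_ne_zero hM hL hc
  rw [conj_monomialSum ψ _ (exists_pow_succ_eq_neg_one hL), hL] at hnorm
  rw [sq, hnorm, Nat.cast_pow (p ^ e)]

theorem monomialSum_succ (hL : Fintype.card L = (p ^ e) ^ (2 * k)) (hψ : ψ ≠ 1)
    (hψp : ∀ x, ψ (x ^ p) = ψ x) (hM : (p ^ e + 1) * M = Fintype.card Lˣ) (c : Lˣ) :
    monomialSum ψ (p ^ e + 1) (c : L)
      = (-(p ^ e : ℕ)) ^ k * (1 - if c ^ M = (-1) ^ k then ((p ^ e + 1 : ℕ) : ℂ) else 0) := by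
  split_ifs with hc
  swap; · rw [monomialSum_succ_of_ne hL hψ hψp hM hc, sub_zero, mul_one]
  set T := monomialSum ψ (p ^ e + 1) (c : L) with hT
  -- `T` is the value on the whole exceptional coset, and all the values add up to `0`.
  have hvalue (c' : Lˣ) : monomialSum ψ (p ^ e + 1) (c' : L)
      = (-(p ^ e : ℕ)) ^ k + if c' ^ M = (-1) ^ k then T - (-(p ^ e : ℕ)) ^ k else 0 := by
    split_ifs with hc'
    · obtain ⟨y, hy⟩ := (exists_pow_eq_iff_pow_eq_one hM (c' / c)).mpr (by
        rw [div_pow, hc', hc, div_self'])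
      rw [add_sub_cancel, hT, ← monomialSum_mul_pow ψ _ (c : L) y, ← Units.val_pow_eq_pow_val,
        ← Units.val_mul, hy, mul_div_cancel]
    · rw [monomialSum_succ_of_ne hL hψ hψp hM hc', add_zero]
  have hcard : #{c' : Lˣ | c' ^ M = (-1) ^ k} = M := by
    rw [card_filter_pow_eq hM, if_pos]
    rw [← pow_mul, mul_comm, pow_mul, pow_succ, neg_one_units_pow_char_pow, neg_one_mul,
      neg_neg, one_pow]
  have hsum := sum_units_monomialSum hψ (Nat.succ_ne_zero (p ^ e))
  simp only [hvalue, Nat.succ_eq_add_one, Finset.sum_add_distrib, Finset.sum_const,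
    ← Finset.sum_filter, hcard, Finset.card_univ, ← hM, nsmul_eq_mul] at hsum
  have hM0 : (M : ℂ) ≠ 0 := Nat.cast_ne_zero.mpr (by
    rintro rfl
    exact Fintype.card_ne_zero hM.symm)
  apply mul_left_cancel₀ hM0
  push_cast at hsum ⊢
  linear_combination hsum

theorem monomialSum_of_mul_eq_succ (hL : Fintype.card L = (p ^ e) ^ (2 * k)) (hψ : ψ ≠ 1)
    (hψp : ∀ x, ψ (x ^ p) = ψ x) {N D : ℕ} (hNM : N * M = p ^ e + 1)
    (hD : N * D = Fintype.card Lˣ) (c : Lˣ) :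
    monomialSum ψ N (c : L)
      = (-(p ^ e : ℕ)) ^ k * (1 - if c ^ D = (-1) ^ (k * M) then (N : ℂ) else 0) := by
  obtain ⟨hN, hM⟩ := mul_ne_zero_iff.mp (hNM.trans_ne (Nat.succ_ne_zero _))
  set A := (p ^ e - 1) * ∑ i ∈ range k, ((p ^ e) ^ 2) ^ i
  have hA : (p ^ e + 1) * A = Fintype.card Lˣ := succ_mul_eq_card_units hL
  have hDA : D = A * M := Nat.eq_of_mul_eq_mul_left (Nat.pos_of_ne_zero hN) (by
    rw [hD, ← hA, ← hNM]; ring)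
  have hcard : #{y : Lˣ | (c * y ^ N) ^ A = (-1) ^ k}
      = if c ^ D = (-1) ^ (k * M) then N * A else 0 := by
    have hfilter (y : Lˣ) : (c * y ^ N) ^ A = (-1) ^ k ↔ y ^ (N * A) = (-1) ^ k / c ^ A := by
      rw [mul_pow, ← pow_mul, eq_div_iff_mul_eq', mul_comm]
    simp only [hfilter]
    rw [card_filter_pow_eq (N := M) (by rw [← hA, ← hNM]; ring)]
    simp only [div_pow, ← pow_mul, div_eq_one, ← hDA, eq_comm (b := c ^ D)]
  have havg := sum_units_monomialSum_mul_pow hN hM ψ (c : L)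
  simp only [hNM, ← Units.val_pow_eq_pow_val, ← Units.val_mul,
    monomialSum_succ hL hψ hψp hA, ← Finset.mul_sum, Finset.sum_sub_distrib, Finset.sum_const,
    ← Finset.sum_filter, hcard, Finset.card_univ, nsmul_eq_mul, ← hA] at havg
  have hA0 : ((p ^ e + 1 : ℕ) * A : ℂ) ≠ 0 := by
    exact_mod_cast hA.trans_ne Fintype.card_ne_zero
  apply mul_left_cancel₀ hA0
  rw [← Nat.cast_mul, ← havg]
  split_ifs <;> push_cast [← hNM] <;> ring

theorem generator_pow_eq_neg_one {γ : Lˣ} (hγ : ∀ x, x ∈ Subgroup.zpowers γ) {a : ℕ}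
    (ha : 2 * a = Fintype.card Lˣ) : γ ^ a = -1 := by
  have hsq : γ ^ a = 1 ∨ γ ^ a = -1 := Units.inv_eq_self_iff _ |>.mp <|
    inv_eq_of_mul_eq_one_right (by rw [← pow_add, ← two_mul, ha, pow_card_eq_one])
  refine hsq.resolve_left fun hone => ?_
  have hdvd := orderOf_dvd_of_pow_eq_one hone
  rw [orderOf_eq_card_of_forall_mem_zpowers hγ, Nat.card_eq_fintype_card, ← ha] at hdvd
  have hpos := Fintype.card_pos (α := Lˣ)
  have hle := Nat.le_of_dvd (by omega) hdvd
  omega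

theorem generator_pow_kConst_pow {γ : Lˣ} (hγ : ∀ x, x ∈ Subgroup.zpowers γ) (n t : ℕ) {N D : ℕ}
    (hNM : N * M = p ^ e + 1) (hD : N * D = Fintype.card Lˣ) :
    (γ ^ kConst p e n t N) ^ D = (-1) ^ (n * t * M) := by
  have hN : 0 < N := Nat.pos_of_ne_zero (by rintro rfl; simp at hNM)
  rw [kConst, ← hNM, Nat.mul_div_cancel_left M hN]
  obtain rfl | hp2 := (Fact.out : p.Prime).eq_two_or_odd'
  · have hone : (-1 : Lˣ) = 1 := by
      rw [← neg_one_units_pow_char_pow L 2 1, pow_one, neg_one_sq]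
    simp [hone]
  have heven : Even N ∨ Even M := Nat.even_mul.mp (hNM ▸ hp2.pow.add_one)
  simp only [← even_iff_two_dvd, Nat.not_even_iff_odd]
  split_ifs with h
  · obtain ⟨-, hnt, hM⟩ := h
    obtain ⟨b, rfl⟩ := (heven.resolve_right (Nat.not_even_iff_odd.mpr hM)).two_dvd
    rw [Nat.mul_div_cancel_left b two_pos, ← pow_mul,
      generator_pow_eq_neg_one hγ ((mul_assoc 2 b D).symm.trans hD), (hnt.mul hM).neg_one_pow]
  · have hp2' : 2 < p := (Fact.out : p.Prime).two_le.lt_of_ne' (by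
      rintro rfl
      exact absurd hp2 (by decide))
    have hntM : Even (n * t * M) := by
      rw [Nat.even_mul]
      by_contra! hne
      exact h ⟨hp2', Nat.not_even_iff_odd.mp hne.1, Nat.not_even_iff_odd.mp hne.2⟩
    rw [pow_zero, one_pow, hntM.neg_one_pow]

theorem monomialSum_eq_of_dvd_succ {p e n t N : ℕ} [Fact p.Prime]
    (hL : Fintype.card L = (p ^ e) ^ (2 * (n * t))) {γ : Lˣ} (hγ : ∀ x, x ∈ Subgroup.zpowers γ)
    (hN : N ∣ p ^ e + 1) (hψ : ψ ≠ 1) (hψp : ∀ x, ψ (x ^ p) = ψ x) (c : Lˣ) :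
    monomialSum ψ N (c : L) = (-(p ^ e : ℕ)) ^ (n * t)
      * (1 - if ∃ y, γ ^ kConst p e n t N * y ^ N = c then (N : ℂ) else 0) := by
  have : CharP L p := charP_of_card_eq_prime_pow (hL.trans (pow_mul p e _).symm)
  obtain ⟨M, hM⟩ := hN
  obtain ⟨D, hD⟩ : N ∣ Fintype.card Lˣ :=
    (Dvd.intro M hM.symm).trans (succ_dvd_card_units hL)
  have hcoset : (∃ y, γ ^ kConst p e n t N * y ^ N = c) ↔ c ^ D = (-1) ^ (n * t * M) := by
    rw [← generator_pow_kConst_pow hγ n t hM.symm hD.symm, ← div_eq_one, ← div_pow,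
      ← exists_pow_eq_iff_pow_eq_one hD.symm]
    simp only [eq_div_iff_mul_eq', mul_comm]
  simp only [monomialSum_of_mul_eq_succ hL hψ hψp hM.symm hD.symm, hcoset]

end Semiprimitive

section FiniteFieldCard

theorem natCard_eq_of_finrank_eq {F E : Type*} [Field F] [Field E] [Finite E] [Algebra F E]
    {P n t : ℕ} (hF : Nat.card F = P ^ (2 * n)) (ht : Module.finrank F E = t) :
    Nat.card E = P ^ (2 * (n * t)) := by
  rw [Module.natCard_eq_pow_finrank (K := F), hF, ht, ← pow_mul, mul_assoc]

variable {F : Type*} [Field F] [Finite F] {p e n : ℕ}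

theorem ne_zero_of_natCard_eq (hF : Nat.card F = (p ^ e) ^ (2 * n)) : n ≠ 0 := by
  rintro rfl
  exact Finite.one_lt_card.ne' (hF.trans (pow_zero _))

theorem dvd_natCard_units_of_dvd_succ {s : ℕ} (hF : Nat.card F = (p ^ e) ^ (2 * n))
    (hs : s ∣ p ^ e + 1) : s ∣ Nat.card Fˣ := by
  classical
  cases nonempty_fintype F
  rw [Nat.card_eq_fintype_card] at hF ⊢
  exact hs.trans (succ_dvd_card_units hF)

variable [Fact p.Prime]

theorem charP_of_natCard_eq (hF : Nat.card F = (p ^ e) ^ (2 * n)) : CharP F p := by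
  cases nonempty_fintype F
  exact charP_of_card_eq_prime_pow
    (Nat.card_eq_fintype_card.symm.trans (hF.trans (pow_mul p e _).symm))

theorem natCast_ne_zero_of_not_dvd (hF : Nat.card F = (p ^ e) ^ (2 * n)) {M : ℕ} (hM : ¬p ∣ M) :
    (M : F) ≠ 0 := by
  have := charP_of_natCard_eq hF
  rwa [Ne, CharP.cast_eq_zero_iff F p]

end FiniteFieldCard

section TracePowCount

theorem exists_addChar_ne_one_frobenius_invariant (F : Type*) [Field F] [Finite F] (p : ℕ)
    [Fact p.Prime] [CharP F p] : ∃ ψ : AddChar F ℂ, ψ ≠ 1 ∧ ∀ x, ψ (x ^ p) = ψ x := by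
  let := ZMod.algebra F p
  refine ⟨(ZMod.stdAddChar (N := p)).compAddMonoidHom (Algebra.trace (ZMod p) F).toAddMonoidHom,
    fun hψ => ?_, fun x => ?_⟩
  · obtain ⟨y, hy⟩ := Algebra.trace_surjective (ZMod p) F 1
    have hone : ZMod.stdAddChar (N := p) (Algebra.trace (ZMod p) F y) = 1 := by
      simpa using DFunLike.congr_fun hψ y
    rw [hy, ← AddChar.map_zero_eq_one (ZMod.stdAddChar (N := p))] at hone
    exact one_ne_zero (ZMod.injective_stdAddChar hone)
  · have htrace := Algebra.trace_eq_of_algEquiv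
      (FiniteField.frobeniusAlgEquivOfAlgebraic (ZMod p) F) x
    rw [FiniteField.coe_frobeniusAlgEquivOfAlgebraic, ZMod.card] at htrace
    exact congrArg (ZMod.stdAddChar (N := p)) htrace

theorem trace_pow_char {F E : Type*} [Field F] [Field E] [Finite E] [Algebra F E] (p : ℕ)
    [Fact p.Prime] [CharP F p] (x : E) : Algebra.trace F E (x ^ p) = Algebra.trace F E x ^ p := by
  have : CharP E p := charP_of_injective_algebraMap' F p
  apply (algebraMap F E).injective
  simp only [map_pow, FiniteField.algebraMap_trace_eq_sum_pow, sum_pow_char, ← pow_mul, mul_comm]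

variable {F E : Type*} [Field F] [Field E] [Algebra F E] {ψ : AddChar F ℂ}

/-- The additive character `ψ ∘ Tr_{E/F}` of `E`, which turns character sums detecting a value of
the trace to `F` into Weil sums over `E`. -/
noncomputable def traceChar (ψ : AddChar F ℂ) (E : Type*) [Field E] [Algebra F E] : AddChar E ℂ :=
  ψ.compAddMonoidHom (Algebra.trace F E).toAddMonoidHom

theorem traceChar_apply (ψ : AddChar F ℂ) (x : E) :
    traceChar ψ E x = ψ (Algebra.trace F E x) := rfl

theorem traceChar_ne_one [Finite E] (hψ : ψ ≠ 1) : traceChar ψ E ≠ 1 := by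
  have := Finite.of_injective _ (algebraMap F E).injective
  contrapose hψ
  ext x
  obtain ⟨y, rfl⟩ := Algebra.trace_surjective F E x
  rw [← traceChar_apply, hψ, AddChar.one_apply, AddChar.one_apply]

theorem traceChar_pow_char [Finite E] {p : ℕ} [Fact p.Prime] [CharP F p]
    (hψp : ∀ x, ψ (x ^ p) = ψ x) (x : E) : traceChar ψ E (x ^ p) = traceChar ψ E x := by
  rw [traceChar_apply, trace_pow_char p, hψp, traceChar_apply]

/-- The number of `y ∈ E` (`y = 0` included) with `Tr_{E/F}(c yᴺ) = b`. Up to the contribution of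
`y = 0` this is `N` times the number of elements of trace `b` in the coset of `c` modulo `N`-th
powers, provided that `N` divides the order of `Eˣ`. -/
noncomputable def tracePowCount (N : ℕ) (c : E) (b : F) : ℕ :=
  Nat.card {y : E // Algebra.trace F E (c * y ^ N) = b}

variable [Fintype F] [Fintype E]

theorem sum_addChar_mul_sub [DecidableEq F] (hψ : ψ ≠ 1) (b y : F) :
    ∑ a, ψ (a * (y - b)) = if y = b then (Fintype.card F : ℂ) else 0 := by
  simp_rw [mul_comm _ (y - b)]
  split_ifs with h
  · simp [h]
  · exact sum_addChar_mul_eq_zero hψ (sub_ne_zero.mpr h)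

theorem card_mul_tracePowCount [DecidableEq F] (hψ : ψ ≠ 1) (N : ℕ) (c : E) (b : F) :
    (Fintype.card F : ℂ) * tracePowCount N c b = Fintype.card E
      + ∑ a : Fˣ, ψ (-(a * b)) * monomialSum (traceChar ψ E) N (algebraMap F E a * c) := by
  have hterm (a : F) (y : E) : ψ (a * (Algebra.trace F E (c * y ^ N) - b))
      = ψ (-(a * b)) * traceChar ψ E (algebraMap F E a * c * y ^ N) := by
    rw [traceChar_apply, mul_assoc, ← Algebra.smul_def, map_smul, smul_eq_mul,
      ← AddChar.map_add_eq_mul]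
    congr 1
    ring
  calc (Fintype.card F : ℂ) * tracePowCount N c b
      = ∑ y : E, ∑ a : F, ψ (a * (Algebra.trace F E (c * y ^ N) - b)) := by
        simp only [sum_addChar_mul_sub hψ, ← Finset.sum_filter, Finset.sum_const, nsmul_eq_mul,
          tracePowCount, Nat.card_eq_fintype_card, Fintype.card_subtype]
        ring
    _ = ∑ a : F, ψ (-(a * b)) * monomialSum (traceChar ψ E) N (algebraMap F E a * c) := by
        rw [Finset.sum_comm]
        simp only [hterm, monomialSum, Finset.mul_sum]
    _ = _ := by
        rw [sum_eq_apply_zero_add_sum_units]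
        simp [monomialSum]

end TracePowCount

section KConst

variable {p e : ℕ}

theorem kConst_modEq_of_dvd (hp : p.Prime) (n t : ℕ) {l N : ℕ} (hl : l ∣ N) (hN : N ∣ p ^ e + 1) :
    kConst p e n t N ≡ kConst p e n t l [MOD l] := by
  obtain ⟨c, rfl⟩ := hl
  obtain ⟨v, hv⟩ := hN
  have hpos : 0 < l * c := Nat.pos_of_ne_zero fun h0 => by simp [h0] at hv
  have hl0 : 0 < l := Nat.pos_of_mul_pos_right hpos
  have hdivN : (p ^ e + 1) / (l * c) = v := by rw [hv, Nat.mul_div_cancel_left v hpos]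
  have hdivl : (p ^ e + 1) / l = c * v := by rw [hv, mul_assoc, Nat.mul_div_cancel_left _ hl0]
  simp only [kConst, hdivN, hdivl, Nat.prime_two.dvd_mul (m := c), not_or]
  by_cases hpt : 2 < p ∧ ¬2 ∣ n * t ∧ ¬2 ∣ v
  · have heven : 2 ∣ l * c := by
      have hodd := (hp.odd_of_ne_two hpt.1.ne').pow (n := e)
      exact (Nat.prime_two.dvd_mul.mp (hv ▸ hodd.add_one.two_dvd)).resolve_right hpt.2.2
    rw [if_pos hpt]
    by_cases hc : 2 ∣ c
    · rw [if_neg fun h => h.2.2.1 hc, Nat.mul_div_assoc l hc]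
      exact Nat.modEq_zero_iff_dvd.mpr (Dvd.intro _ rfl)
    · rw [if_pos ⟨hpt.1, hpt.2.1, hc, hpt.2.2⟩]
      obtain ⟨b, rfl⟩ := (Nat.prime_two.dvd_mul.mp heven).resolve_right hc
      obtain ⟨c', rfl⟩ := Nat.odd_iff.mpr (Nat.two_dvd_ne_zero.mp hc)
      rw [mul_assoc, Nat.mul_div_cancel_left _ two_pos, Nat.mul_div_cancel_left _ two_pos]
      simp [Nat.ModEq, mul_add, ← mul_assoc, mul_comm b 2]
  · rw [if_neg hpt, if_neg fun h => hpt ⟨h.1, h.2.1, h.2.2.2⟩]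

theorem kConst_one_eq_of_gcd (hp : p.Prime) (n : ℕ) {t l u : ℕ} (hlu : l * u ∣ p ^ e + 1)
    (hl : t.gcd (l * u) = l) : kConst p e n 1 u = kConst p e n t u := by
  obtain ⟨v, hv⟩ := hlu
  have hu0 : 0 < u := Nat.pos_of_ne_zero fun h0 => by simp [h0] at hv
  have hdiv : (p ^ e + 1) / u = l * v := by
    rw [hv, mul_right_comm, Nat.mul_div_cancel _ hu0]
  by_cases h : 2 < p ∧ ¬2 ∣ l * v
  · suffices ht : ¬2 ∣ t by simp [kConst, Nat.prime_two.dvd_mul, ht]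
    have hodd := (hp.odd_of_ne_two h.1.ne').pow (n := e)
    have h2u : 2 ∣ u := by
      have h2 : 2 ∣ l * v * u := by rw [mul_right_comm, ← hv]; exact hodd.add_one.two_dvd
      exact (Nat.prime_two.dvd_mul.mp h2).resolve_left h.2
    exact fun ht => h.2 ((hl ▸ Nat.dvd_gcd ht (h2u.mul_left l)).mul_right v)
  · rw [kConst, kConst, hdiv, if_neg fun hc => h ⟨hc.1, hc.2.2⟩,
      if_neg fun hc => h ⟨hc.1, hc.2.2⟩]

theorem dvd_kConst_sub_iff (hp : p.Prime) (n t : ℕ) {l u : ℕ} (hlu : l * u ∣ p ^ e + 1) (i : ℕ) :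
    (l : ℤ) ∣ (kConst p e n t (l * u) : ℤ) - i ↔ i ≡ kConst p e n t l [MOD l] := by
  rw [← Nat.modEq_iff_dvd]
  have hk := kConst_modEq_of_dvd hp n t (Dvd.intro u rfl) hlu
  exact ⟨fun h => h.trans hk, fun h => h.trans hk.symm⟩

end KConst

section GeometricSum

theorem gcd_geom_eq_gcd {q N : ℕ} (hq : 2 ≤ q) (hN : N ∣ q - 1) (t : ℕ) :
    ((q ^ t - 1) / (q - 1)).gcd N = t.gcd N := by
  have hmod : q ≡ 1 [MOD N] := ((Nat.modEq_iff_dvd' (by omega)).mpr hN).symm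
  have hsum : ∑ i ∈ range t, q ^ i ≡ ∑ _i ∈ range t, 1 [MOD N] :=
    Nat.ModEq.sum fun i _ => by simpa using hmod.pow i
  rw [← Nat.geomSum_eq hq]
  simpa using hsum.gcd_eq

theorem geom_eq_mul_and_coprime {q t l u : ℕ} (hq : 2 ≤ q) (hlu : l * u ∣ q - 1)
    (hl : t.gcd (l * u) = l) (hl0 : l ≠ 0) :
    (q ^ t - 1) / (q - 1) = l * ((q ^ t - 1) / (q - 1) / l)
      ∧ ((q ^ t - 1) / (q - 1) / l).Coprime u := by
  have hgcd := (gcd_geom_eq_gcd hq hlu t).trans hl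
  refine ⟨(Nat.mul_div_cancel' (hgcd ▸ Nat.gcd_dvd_left _ _)).symm, ?_⟩
  have hcop := Nat.coprime_div_gcd_div_gcd (hgcd.symm ▸ Nat.pos_of_ne_zero hl0)
  rwa [hgcd, Nat.mul_div_cancel_left u (Nat.pos_of_ne_zero hl0)] at hcop

end GeometricSum

section UnitNorm

theorem unitNorm_generates (L : Type*) {K : Type*} [Field L] [Field K] [Finite K] [Algebra L K]
    {γ : Kˣ} (hγ : ∀ x, x ∈ Subgroup.zpowers γ) (x : Lˣ) : x ∈ Subgroup.zpowers (unitNorm L γ) := by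
  obtain ⟨y, rfl⟩ := FiniteField.unitsMap_norm_surjective L K x
  obtain ⟨z, rfl⟩ := hγ y
  exact ⟨z, (map_zpow (Units.map (Algebra.norm L : K →* L)) γ z).symm⟩

variable {F E : Type*} [Field F] [Field E] [Finite E] [Algebra F E]

theorem map_unitNorm (γ : Eˣ) : Units.map (algebraMap F E : F →* E) (unitNorm F γ)
    = γ ^ ((Nat.card F ^ Module.finrank F E - 1) / (Nat.card F - 1)) := by
  have := Module.natCard_eq_pow_finrank (K := F) (V := E)
  ext
  rw [Units.val_pow_eq_pow_val, ← this]
  exact FiniteField.algebraMap_norm_eq_pow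

end UnitNorm

section RealForm

theorem neg_natCast_pow_eq {P n q : ℕ} (hq : q = P ^ (2 * n)) :
    (-(P : ℝ)) ^ n = (-1) ^ n * √(q : ℝ) := by
  rw [hq, mul_comm 2, pow_mul, Nat.cast_pow, Real.sqrt_sq (Nat.cast_nonneg _), neg_pow,
    Nat.cast_pow]

theorem natCast_eq_of_mul_eq {P n t q C : ℕ} {z : ℝ} (hq : q = P ^ (2 * n)) (hq0 : q ≠ 0)
    (ht : t ≠ 0) (h : (q : ℂ) * C = (-(P : ℂ)) ^ (n * t) * ((-(P : ℂ)) ^ (n * t) - z)) :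
    (C : ℝ) = (q : ℝ) ^ (t - 1) - (-1) ^ (n * t) * z * √((q : ℝ) ^ ((t : ℤ) - 2)) := by
  have hq0' : (q : ℝ) ≠ 0 := mod_cast hq0
  have hX : (-(P : ℝ)) ^ (n * t) = (-1) ^ (n * t) * (q * √((q : ℝ) ^ ((t : ℤ) - 2))) := by
    have hsqrt : √((q : ℝ) ^ t) = q * √((q : ℝ) ^ ((t : ℤ) - 2)) := by
      rw [← zpow_natCast, ← Real.sqrt_sq (Nat.cast_nonneg q), ← Real.sqrt_mul (by positivity),
        Real.sqrt_sq (Nat.cast_nonneg q), ← zpow_natCast (q : ℝ) 2, ← zpow_add₀ hq0']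
      congr 2
      push_cast
      ring
    rw [neg_natCast_pow_eq (q := q ^ t) (by rw [hq, ← pow_mul, mul_assoc]), Nat.cast_pow, hsqrt]
  have hXX : (-(P : ℝ)) ^ (n * t) * (-(P : ℝ)) ^ (n * t) = q * (q : ℝ) ^ (t - 1) := by
    rw [← mul_pow, neg_mul_neg, ← pow_succ', Nat.sub_add_cancel (Nat.pos_of_ne_zero ht), hq]
    push_cast
    ring
  have hreal : (q : ℝ) * C = (-(P : ℝ)) ^ (n * t) * ((-(P : ℝ)) ^ (n * t) - z) := mod_cast h
  rw [mul_sub, hXX, hX] at hreal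
  exact mul_left_cancel₀ hq0' (by linear_combination hreal)

end RealForm

section SemiprimitiveCount

variable {F E : Type*} [Field F] [Field E] [Algebra F E] {p e n t N : ℕ} [Fact p.Prime]
  {γ : Eˣ}

theorem monomialSum_generator_pow {L : Type*} [Field L] [Fintype L]
    (hL : Fintype.card L = (p ^ e) ^ (2 * (n * t))) {γ : Lˣ} (hγ : ∀ x, x ∈ Subgroup.zpowers γ)
    (hN : N ∣ p ^ e + 1) {ψ : AddChar L ℂ} (hψ : ψ ≠ 1) (hψp : ∀ x, ψ (x ^ p) = ψ x) (j : ℕ) :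
    monomialSum ψ N ((γ ^ j : Lˣ) : L) = (-(p ^ e : ℕ)) ^ (n * t)
      * (1 - if j ≡ kConst p e n t N [MOD N] then (N : ℂ) else 0) := by
  classical
  have hcard := hN.trans (succ_dvd_card_units hL)
  have hiff := exists_zpow_mul_pow_eq_zpow_iff hγ hcard (kConst p e n t N) j
  simp only [zpow_natCast, Int.natCast_modEq_iff] at hiff
  rw [monomialSum_eq_of_dvd_succ hL hγ hN hψ hψp, if_congr hiff rfl rfl]

open scoped Classical in
theorem card_mul_tracePowCount_eq [Fintype F] [Fintype E]
    (hE : Fintype.card E = (p ^ e) ^ (2 * (n * t))) (hγ : ∀ x, x ∈ Subgroup.zpowers γ)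
    (hN : N ∣ p ^ e + 1) {ψ : AddChar F ℂ} (hψ : ψ ≠ 1) (hψp : ∀ x, ψ (x ^ p) = ψ x) (i : ℕ)
    (b : F) :
    (Fintype.card F : ℂ) * tracePowCount N ((γ ^ i : Eˣ) : E) b =
      (-(p ^ e : ℕ)) ^ (n * t) * ((-(p ^ e : ℕ)) ^ (n * t) + ∑ a : Fˣ, ψ (-(a * b))
        - N * ∑ a : Fˣ with ∃ y, γ ^ ((kConst p e n t N : ℤ) - i) * y ^ N
            = Units.map (algebraMap F E : F →* E) a, ψ (-(a * b))) := by
  have : CharP E p := charP_of_card_eq_prime_pow (hE.trans (pow_mul p e _).symm)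
  have : CharP F p := (algebraMap F E).charP (algebraMap F E).injective p
  have hcoset (a : Fˣ) : (∃ y, γ ^ kConst p e n t N * y ^ N
        = Units.map (algebraMap F E : F →* E) a * γ ^ i)
      ↔ ∃ y, γ ^ ((kConst p e n t N : ℤ) - i) * y ^ N
        = Units.map (algebraMap F E : F →* E) a := by
    simp only [zpow_sub, zpow_natCast, mul_right_comm, mul_inv_eq_iff_eq_mul]
  have hterm (a : Fˣ) := monomialSum_eq_of_dvd_succ hE hγ hN (traceChar_ne_one hψ)
    (traceChar_pow_char hψp) (Units.map (algebraMap F E : F →* E) a * γ ^ i)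
  simp only [hcoset, Units.val_mul, Units.coe_map, MonoidHom.coe_coe] at hterm
  have hsq : (Fintype.card E : ℂ) = (-(p ^ e : ℕ)) ^ (n * t) * (-(p ^ e : ℕ)) ^ (n * t) := by
    rw [hE, ← mul_pow, neg_mul_neg]
    push_cast
    ring
  rw [card_mul_tracePowCount hψ, Finset.sum_filter, hsq, add_sub_assoc, mul_add, Finset.mul_sum,
    ← Finset.sum_sub_distrib, Finset.mul_sum]
  congr 1
  refine Finset.sum_congr rfl fun a _ => ?_
  rw [hterm]
  split_ifs <;> ring

end SemiprimitiveCount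

section TracePowCountValues

variable {F E : Type*} [Field F] [Field E] [Algebra F E] {p e n t l u : ℕ} {γ : Eˣ}

theorem geom_card_eq_mul_and_coprime [Fintype F] (hF : Fintype.card F = (p ^ e) ^ (2 * n))
    (hlu : l * u ∣ p ^ e + 1) (hl : t.gcd (l * u) = l) :
    (Fintype.card F ^ t - 1) / (Fintype.card F - 1)
        = l * ((Fintype.card F ^ t - 1) / (Fintype.card F - 1) / l)
      ∧ ((Fintype.card F ^ t - 1) / (Fintype.card F - 1) / l).Coprime u := by
  classical
  refine geom_eq_mul_and_coprime Fintype.one_lt_card ?_ hl (by rintro rfl; simp at hlu)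
  rw [← Fintype.card_units]
  exact hlu.trans (succ_dvd_card_units hF)

open scoped Classical in
theorem mul_sum_filter_map_units_eq [Fintype F] [Fintype E]
    (hF : Fintype.card F = (p ^ e) ^ (2 * n))
    (ht : Module.finrank F E = t) (hγ : ∀ x, x ∈ Subgroup.zpowers γ) (hlu : l * u ∣ p ^ e + 1)
    (hl : t.gcd (l * u) = l) {D j : ℤ} (hD : (l : ℤ) ∣ D)
    (hj : ((Fintype.card F ^ t - 1) / (Fintype.card F - 1) / l : ℕ) * j ≡ D / l [ZMOD u])
    (f : Fˣ → ℂ) :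
    ((l * u : ℕ) : ℂ) * ∑ a : Fˣ with ∃ y, γ ^ D * y ^ (l * u)
        = Units.map (algebraMap F E : F →* E) a, f a
      = l * ∑ x, f (unitNorm F γ ^ j * x ^ u) := by
  obtain ⟨D, rfl⟩ := hD
  have hE : Fintype.card E = (p ^ e) ^ (2 * (n * t)) := Nat.card_eq_fintype_card.symm.trans
    (natCard_eq_of_finrank_eq (Nat.card_eq_fintype_card.trans hF) ht)
  have huF : u ∣ Fintype.card Fˣ := (dvd_mul_left u l).trans (hlu.trans (succ_dvd_card_units hF))
  have hluE : l * u ∣ Fintype.card Eˣ := hlu.trans (succ_dvd_card_units hE)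
  have hl0 : l ≠ 0 := by rintro rfl; simp at hlu
  obtain ⟨hgeom, hcop⟩ := geom_card_eq_mul_and_coprime hF hlu hl
  have hφ := map_unitNorm (F := F) γ
  rw [ht, Nat.card_eq_fintype_card, hgeom] at hφ
  rw [Int.mul_ediv_cancel_left _ (mod_cast hl0)] at hj
  have hsum := smul_sum_filter_zpow_mul_pow_eq_map (unitNorm_generates F hγ) hγ hφ hl0 hcop
    huF hluE hj f
  rwa [nsmul_eq_mul, nsmul_eq_mul] at hsum

open scoped Classical in
theorem sum_filter_map_units_eq_zero [Fintype F] [Fintype E]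
    (hF : Fintype.card F = (p ^ e) ^ (2 * n)) (ht : Module.finrank F E = t)
    (hγ : ∀ x, x ∈ Subgroup.zpowers γ) (hlu : l * u ∣ p ^ e + 1) (hl : t.gcd (l * u) = l) {D : ℤ}
    (hD : ¬(l : ℤ) ∣ D) (f : Fˣ → ℂ) :
    ∑ a : Fˣ with ∃ y, γ ^ D * y ^ (l * u) = Units.map (algebraMap F E : F →* E) a, f a = 0 := by
  have hE : Fintype.card E = (p ^ e) ^ (2 * (n * t)) := Nat.card_eq_fintype_card.symm.trans
    (natCard_eq_of_finrank_eq (Nat.card_eq_fintype_card.trans hF) ht)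
  have hluE : l * u ∣ Fintype.card Eˣ := hlu.trans (succ_dvd_card_units hE)
  obtain ⟨hgeom, -⟩ := geom_card_eq_mul_and_coprime hF hlu hl
  have hφ := map_unitNorm (F := F) γ
  rw [ht, Nat.card_eq_fintype_card] at hφ
  refine (congrArg (fun A : Finset Fˣ => ∑ a ∈ A, f a)
    (Finset.filter_false_of_mem fun a _ h => hD ?_)).trans Finset.sum_empty
  exact dvd_of_zpow_mul_pow_eq_map (unitNorm_generates F hγ) hγ hφ (Dvd.intro _ hgeom.symm)
    (Dvd.intro u rfl) hluE h

variable [Fact p.Prime]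

theorem exists_addChar_of_card [Finite F] (hF : Nat.card F = (p ^ e) ^ (2 * n)) :
    ∃ ψ : AddChar F ℂ, ψ ≠ 1 ∧ ∀ x, ψ (x ^ p) = ψ x := by
  have := charP_of_natCard_eq hF
  exact exists_addChar_ne_one_frobenius_invariant F p

theorem tracePowCount_zero_eq [Finite F] [Finite E] (hF : Nat.card F = (p ^ e) ^ (2 * n))
    (ht : Module.finrank F E = t) (hγ : ∀ x, x ∈ Subgroup.zpowers γ) (hlu : l * u ∣ p ^ e + 1)
    (hl : t.gcd (l * u) = l) (i : ℕ) :
    (tracePowCount (l * u) ((γ ^ i : Eˣ) : E) (0 : F) : ℝ) = (Nat.card F : ℝ) ^ (t - 1)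
      - (-1) ^ (n * t)
        * (((if i ≡ kConst p e n t l [MOD l] then (l : ℝ) else 0) - 1) * ((Nat.card F : ℝ) - 1))
        * √((Nat.card F : ℝ) ^ ((t : ℤ) - 2)) := by
  classical
  cases nonempty_fintype F
  cases nonempty_fintype E
  refine natCast_eq_of_mul_eq hF Nat.card_pos.ne' (ht ▸ Module.finrank_pos.ne') ?_
  obtain ⟨ψ, hψ, hψp⟩ := exists_addChar_of_card hF
  have hE := natCard_eq_of_finrank_eq hF ht
  rw [Nat.card_eq_fintype_card] at hF hE ⊢
  have hu0 : u ≠ 0 := by rintro rfl; simp at hlu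
  have hunits : ∑ _a : Fˣ, (1 : ℂ) = Fintype.card F - 1 := by
    simp [Fintype.card_units, Nat.cast_sub Fintype.card_pos]
  rw [card_mul_tracePowCount_eq hE hγ hlu hψ hψp]
  simp only [mul_zero, neg_zero, AddChar.map_zero_eq_one, hunits,
    ← dvd_kConst_sub_iff Fact.out n t hlu i]
  split_ifs with hD
  · obtain ⟨j, hj⟩ := exists_natCast_mul_modEq (geom_card_eq_mul_and_coprime hF hlu hl).2 hu0 _
    rw [mul_sum_filter_map_units_eq hF ht hγ hlu hl hD hj, hunits]
    push_cast
    ring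
  · rw [sum_filter_map_units_eq_zero hF ht hγ hlu hl hD]
    push_cast
    ring

open scoped Classical in
theorem card_mul_tracePowCount_of_ne_zero [Fintype F] [Fintype E]
    (hE : Fintype.card E = (p ^ e) ^ (2 * (n * t))) (hγ : ∀ x, x ∈ Subgroup.zpowers γ)
    {N : ℕ} (hN : N ∣ p ^ e + 1) {ψ : AddChar F ℂ} (hψ : ψ ≠ 1) (hψp : ∀ x, ψ (x ^ p) = ψ x)
    (i : ℕ) {b : F} (hb : b ≠ 0) {ι : ℕ}
    (hι : ((γ ^ ι : Eˣ) : E) = algebraMap F E (-b⁻¹)) :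
    (Fintype.card F : ℂ) * tracePowCount N ((γ ^ i : Eˣ) : E) b =
      (-(p ^ e : ℕ)) ^ (n * t) * ((-(p ^ e : ℕ)) ^ (n * t) - 1
        - N * ∑ a : Fˣ with ∃ y, γ ^ ((kConst p e n t N : ℤ) - i - ι) * y ^ N
            = Units.map (algebraMap F E : F →* E) a, ψ a) := by
  have hψb (a : Fˣ) : ψ (-(a * b)) = ψ (-b * a) := by rw [mul_comm, neg_mul]
  simp only [card_mul_tracePowCount_eq hE hγ hN hψ hψp, hψb,
    sum_units_addChar_mul hψ (neg_ne_zero.mpr hb)]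
  congr 3
  let c : Fˣ := Units.mk0 (-b⁻¹) (neg_ne_zero.mpr (inv_ne_zero hb))
  refine (Finset.sum_equiv (Equiv.mulLeft c) (fun a => ?_) fun a _ => ?_).symm
  · have hγι : γ ^ ι = Units.map (algebraMap F E : F →* E) c := Units.ext hι
    simp only [Finset.mem_filter_univ, Equiv.coe_mulLeft, map_mul, ← hγι]
    rw [zpow_sub γ _ (ι : ℤ)]
    simp only [mul_right_comm _ _ (_ ^ N), zpow_natCast, mul_inv_eq_iff_eq_mul, mul_comm (γ ^ ι)]
  · simp [c, hb]

theorem tracePowCount_eq_of_not_dvd [Finite F] [Finite E] (hF : Nat.card F = (p ^ e) ^ (2 * n))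
    (ht : Module.finrank F E = t) (hγ : ∀ x, x ∈ Subgroup.zpowers γ) (hlu : l * u ∣ p ^ e + 1)
    (hl : t.gcd (l * u) = l) {i ι : ℕ} {b : F} (hb : b ≠ 0)
    (hι : ((γ ^ ι : Eˣ) : E) = algebraMap F E (-b⁻¹))
    (hD : ¬(l : ℤ) ∣ (kConst p e n t (l * u) : ℤ) - i - ι) :
    (tracePowCount (l * u) ((γ ^ i : Eˣ) : E) b : ℝ) = (Nat.card F : ℝ) ^ (t - 1)
      - (-1) ^ (n * t) * √((Nat.card F : ℝ) ^ ((t : ℤ) - 2)) := by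
  classical
  cases nonempty_fintype F
  cases nonempty_fintype E
  rw [← mul_one ((-1) ^ (n * t))]
  refine natCast_eq_of_mul_eq hF Nat.card_pos.ne' (ht ▸ Module.finrank_pos.ne') ?_
  obtain ⟨ψ, hψ, hψp⟩ := exists_addChar_of_card hF
  have hE := natCard_eq_of_finrank_eq hF ht
  rw [Nat.card_eq_fintype_card] at hF hE ⊢
  rw [card_mul_tracePowCount_of_ne_zero hE hγ hlu hψ hψp i hb hι,
    sum_filter_map_units_eq_zero hF ht hγ hlu hl hD]
  push_cast
  ring

theorem tracePowCount_eq_of_dvd [Finite F] [Finite E] (hF : Nat.card F = (p ^ e) ^ (2 * n))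
    (ht : Module.finrank F E = t) (hγ : ∀ x, x ∈ Subgroup.zpowers γ) (hlu : l * u ∣ p ^ e + 1)
    (hl : t.gcd (l * u) = l) {i ι j : ℕ} {b : F} (hb : b ≠ 0)
    (hι : ((γ ^ ι : Eˣ) : E) = algebraMap F E (-b⁻¹))
    (hD : (l : ℤ) ∣ (kConst p e n t (l * u) : ℤ) - i - ι)
    (hj : ((Nat.card F ^ t - 1) / (Nat.card F - 1) / l : ℕ) * j
      ≡ ((kConst p e n t (l * u) : ℤ) - i - ι) / l [ZMOD u]) :
    (tracePowCount (l * u) ((γ ^ i : Eˣ) : E) b : ℝ) = (Nat.card F : ℝ) ^ (t - 1)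
      - (-1) ^ (n * t) * (((-1) ^ n * √(Nat.card F : ℝ)
          * (1 - if j ≡ kConst p e n t u [MOD u] then (u : ℝ) else 0) - 1) * l + 1)
        * √((Nat.card F : ℝ) ^ ((t : ℤ) - 2)) := by
  classical
  cases nonempty_fintype F
  cases nonempty_fintype E
  refine natCast_eq_of_mul_eq hF Nat.card_pos.ne' (ht ▸ Module.finrank_pos.ne') ?_
  obtain ⟨ψ, hψ, hψp⟩ := exists_addChar_of_card hF
  have hE := natCard_eq_of_finrank_eq hF ht
  rw [← neg_natCast_pow_eq hF]
  rw [Nat.card_eq_fintype_card] at hF hE hj ⊢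
  have hu0 : u ≠ 0 := by rintro rfl; simp at hlu
  have hsum := monomialSum_eq_one_add_sum_units hu0 ψ ((unitNorm F γ ^ j : Fˣ) : F)
  rw [monomialSum_generator_pow (t := 1) (hF.trans (by rw [mul_one])) (unitNorm_generates F hγ)
    ((dvd_mul_left u l).trans hlu) hψ hψp, kConst_one_eq_of_gcd Fact.out n hlu hl, mul_one,
    ← sub_eq_iff_eq_add'] at hsum
  rw [card_mul_tracePowCount_of_ne_zero hE hγ hlu hψ hψp i hb hι,
    mul_sum_filter_map_units_eq hF ht hγ hlu hl hD hj]
  simp only [zpow_natCast, Units.val_mul, Units.val_pow_eq_pow_val] at hsum ⊢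
  rw [← hsum]
  split_ifs <;> push_cast <;> ring

end TracePowCountValues

section TraceNormSet

theorem mul_modEq_iff_of_gcd {M s d h i : ℕ} (hd : M.gcd s = d) (hd0 : d ≠ 0) (hdh : d ∣ h)
    (hi : M / d * i ≡ h / d [MOD s / d]) (z : ℤ) :
    z * M ≡ h [ZMOD s] ↔ z ≡ i [ZMOD (s / d : ℕ)] := by
  have hcop : (M / d).Coprime (s / d) := by
    subst hd
    exact Nat.coprime_div_gcd_div_gcd (Nat.pos_of_ne_zero hd0)
  obtain ⟨M, rfl⟩ : d ∣ M := hd ▸ Nat.gcd_dvd_left M s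
  obtain ⟨s, rfl⟩ : d ∣ s := hd ▸ Nat.gcd_dvd_right _ s
  obtain ⟨h, rfl⟩ := hdh
  simp only [Nat.mul_div_cancel_left _ (Nat.pos_of_ne_zero hd0)] at hi hcop ⊢
  have hi' : (M : ℤ) * i ≡ h [ZMOD s] := mod_cast (Int.natCast_modEq_iff.mpr hi)
  rw [← mul_left_modEq_iff_of_coprime hcop, mul_comm z]
  push_cast
  rw [mul_assoc, Int.ModEq.mul_left_cancel_iff' (mod_cast hd0)]
  exact ⟨fun hz => hz.trans hi'.symm, fun hz => hz.trans hi'⟩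

theorem natCard_units_dvd (F E : Type*) [Field F] [Field E] [Algebra F E] :
    Nat.card Fˣ ∣ Nat.card Eˣ :=
  Subgroup.card_dvd_of_injective (Units.map (algebraMap F E : F →* E))
    (Units.map_injective (algebraMap F E).injective)

theorem tracePowCount_eq_card_units_add {F E : Type*} [Field F] [Field E] [Algebra F E]
    [Fintype E] [DecidableEq F] [DecidableEq E] {N : ℕ} (hN : N ≠ 0) (c : E) (b : F) :
    tracePowCount N c b
      = #{y : Eˣ | Algebra.trace F E (c * (y : E) ^ N) = b} + if b = 0 then 1 else 0 := by
  rw [tracePowCount, Nat.card_eq_fintype_card, Fintype.card_subtype, Finset.card_filter,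
    sum_eq_apply_zero_add_sum_units, Finset.card_filter, add_comm]
  simp [hN, eq_comm]

variable {F K : Type*} [Field F] [Field K] [Algebra F K] {E : IntermediateField F K}

section FiniteDimensional

variable [FiniteDimensional F K]

theorem trace_coe_intermediateField (x : E) :
    Algebra.trace F K (x : K) = (Module.finrank E K : F) * Algebra.trace F E x := by
  rw [← Algebra.trace_trace (S := E), ← IntermediateField.algebraMap_apply,
    Algebra.trace_algebraMap, map_nsmul, nsmul_eq_mul]

theorem norm_coe_intermediateField (x : E) :
    Algebra.norm F (x : K) = Algebra.norm F x ^ Module.finrank E K := by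
  rw [← Algebra.norm_norm (S := E), ← IntermediateField.algebraMap_apply,
    Algebra.norm_algebraMap, map_pow]

theorem unitNorm_unitNorm (E : IntermediateField F K) (γ : Kˣ) :
    unitNorm F (unitNorm E γ) = unitNorm F γ :=
  Units.ext (Algebra.norm_norm (S := E))

end FiniteDimensional

variable [Finite F] [Finite K] {γ : Kˣ} {s d h i : ℕ}

theorem norm_mem_coset_iff (hγ : ∀ x, x ∈ Subgroup.zpowers γ) (hs : s ∣ Nat.card Fˣ)
    (hd : (Module.finrank E K).gcd s = d) (hdh : d ∣ h)
    (hi : Module.finrank E K / d * i ≡ h / d [MOD s / d]) (x : Eˣ) :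
    (∃ y ∈ Subgroup.zpowers (unitNorm F γ ^ s),
        Algebra.norm F ((x : E) : K) = ((unitNorm F γ ^ h * y : Fˣ) : F))
      ↔ ∃ y, unitNorm E γ ^ i * y ^ (s / d) = x := by
  classical
  cases nonempty_fintype F
  cases nonempty_fintype E
  have hds : d ∣ s := hd ▸ Nat.gcd_dvd_right _ s
  have hsE : s / d ∣ Fintype.card Eˣ := Nat.card_eq_fintype_card (α := Eˣ) ▸
    (Nat.div_dvd_of_dvd hds).trans (hs.trans (natCard_units_dvd F E))
  have hs0 : s ≠ 0 := ne_zero_of_dvd_ne_zero Nat.card_pos.ne' hs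
  rw [Nat.card_eq_fintype_card] at hs
  obtain ⟨z, rfl⟩ := unitNorm_generates E hγ x
  have hnorm : Algebra.norm F (((unitNorm E γ ^ z : Eˣ) : E) : K)
      = ((unitNorm F γ ^ (z * Module.finrank E K) : Fˣ) : F) := by
    rw [norm_coe_intermediateField, zpow_mul, zpow_natCast, Units.val_pow_eq_pow_val,
      ← unitNorm_unitNorm E γ]
    exact congrArg (fun y : Fˣ => (y : F) ^ _)
      (map_zpow (Units.map (Algebra.norm F : E →* F)) (unitNorm E γ) z)
  calc (∃ y ∈ Subgroup.zpowers (unitNorm F γ ^ s), Algebra.norm F _ = _)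
      ↔ ∃ y, unitNorm F γ ^ (h : ℤ) * y ^ s = unitNorm F γ ^ (z * Module.finrank E K) := by
        simp only [hnorm, Units.val_inj, zpow_natCast, eq_comm (a := _ ^ (z * _)),
          mem_zpowers_generator_pow_iff (unitNorm_generates F hγ), exists_exists_eq_and]
    _ ↔ z ≡ i [ZMOD (s / d : ℕ)] := by
        rw [exists_zpow_mul_pow_eq_zpow_iff (unitNorm_generates F hγ) hs,
          mul_modEq_iff_of_gcd hd (ne_zero_of_dvd_ne_zero hs0 hds) hdh hi]
    _ ↔ ∃ y, unitNorm E γ ^ i * y ^ (s / d) = unitNorm E γ ^ z := by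
        rw [← exists_zpow_mul_pow_eq_zpow_iff (unitNorm_generates E hγ) hsE, zpow_natCast]

open scoped Classical in
theorem ncard_traceNormSet_eq_card_filter [Fintype E] (hγ : ∀ x, x ∈ Subgroup.zpowers γ)
    (hs : s ∣ Nat.card Fˣ) (hd : (Module.finrank E K).gcd s = d) (hdh : d ∣ h)
    (hi : Module.finrank E K / d * i ≡ h / d [MOD s / d]) (hM : (Module.finrank E K : F) ≠ 0)
    (a : F) : (traceNormSet E γ a s h).ncard
      = #{x : Eˣ | (∃ y, unitNorm E γ ^ i * y ^ (s / d) = x)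
          ∧ Algebra.trace F E x = a / Module.finrank E K} := by
  rw [← Set.ncard_coe_finset, ← Set.ncard_image_of_injective _ (Units.val_injective (α := E))]
  congr 1
  ext x
  have htrace : Algebra.trace F K (x : K) = a ↔ Algebra.trace F E x = a / Module.finrank E K := by
    rw [trace_coe_intermediateField, eq_div_iff hM, mul_comm]
  simp only [traceNormSet, Set.mem_ofPred_eq, Set.mem_image, Finset.coe_filter, Finset.mem_univ,
    true_and, ← norm_mem_coset_iff hγ hs hd hdh hi, htrace]
  constructor
  · rintro ⟨htr, y, hy, hxy⟩
    have hx : x ≠ 0 := by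
      rintro rfl
      exact Units.ne_zero _ (hxy.symm.trans (by simp))
    exact ⟨Units.mk0 x hx, ⟨⟨y, hy, hxy⟩, htr⟩, rfl⟩
  · rintro ⟨x, ⟨hnorm, htr⟩, rfl⟩
    exact ⟨htr, hnorm⟩

theorem ncard_traceNormSet_eq (hγ : ∀ x, x ∈ Subgroup.zpowers γ)
    (hs : s ∣ Nat.card Fˣ) (hd : (Module.finrank E K).gcd s = d) (hdh : d ∣ h)
    (hi : Module.finrank E K / d * i ≡ h / d [MOD s / d]) (hM : (Module.finrank E K : F) ≠ 0)
    (a : F) [Decidable (a = 0)] : ((traceNormSet E γ a s h).ncard : ℝ) = (d : ℝ) / s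
      * (tracePowCount (s / d) ((unitNorm E γ ^ i : Eˣ) : E) (a / Module.finrank E K)
          - if a = 0 then 1 else 0) := by
  classical
  cases nonempty_fintype E
  have hds : d ∣ s := hd ▸ Nat.gcd_dvd_right _ s
  have hsE : s / d ∣ Fintype.card Eˣ := Nat.card_eq_fintype_card (α := Eˣ) ▸
    (Nat.div_dvd_of_dvd hds).trans (hs.trans (natCard_units_dvd F E))
  have hs0 : s ≠ 0 := ne_zero_of_dvd_ne_zero Nat.card_pos.ne' hs
  have hd0 : d ≠ 0 := ne_zero_of_dvd_ne_zero hs0 hds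
  have hcard := smul_sum_filter_exists_mul_pow hsE (unitNorm E γ ^ i) fun x : Eˣ =>
    if Algebra.trace F E x = a / Module.finrank E K then 1 else 0
  simp only [smul_eq_mul, ← Finset.card_filter, Finset.filter_filter,
    ← ncard_traceNormSet_eq_card_filter hγ hs hd hdh hi hM] at hcard
  rw [tracePowCount_eq_card_units_add (ne_zero_of_dvd_ne_zero Fintype.card_ne_zero hsE)]
  simp only [Units.val_mul, Units.val_pow_eq_pow_val] at hcard ⊢
  rw [← hcard, div_eq_zero_iff, or_iff_left hM]
  push_cast [Nat.cast_div_charZero hds]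
  field_simp
  ring

end TraceNormSet

section Values

theorem exists_mul_modEq_of_gcd {M s d : ℕ} (hd : M.gcd s = d) (hs : s ≠ 0) (h : ℕ) :
    ∃ i, M / d * i ≡ h / d [MOD s / d] := by
  subst hd
  have hpos : 0 < M.gcd s := Nat.gcd_pos_of_pos_right M (Nat.pos_of_ne_zero hs)
  obtain ⟨i, hi⟩ := exists_natCast_mul_modEq (Nat.coprime_div_gcd_div_gcd hpos)
    (Nat.div_pos (Nat.gcd_le_right _ (Nat.pos_of_ne_zero hs)) hpos).ne' (h / M.gcd s : ℕ)
  exact ⟨i, mod_cast hi⟩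

variable {F K : Type*} [Field F] [Finite F] [Field K] [Finite K] [Algebra F K]
  {E : IntermediateField F K} {γ : Kˣ} {p e n t s d h l u i : ℕ} [Fact p.Prime]

theorem ncard_traceNormSet_zero (hF : Nat.card F = (p ^ e) ^ (2 * n))
    (ht : Module.finrank F E = t) (hγ : ∀ x, x ∈ Subgroup.zpowers γ) (hs : s ∣ p ^ e + 1)
    (hd : (Module.finrank E K).gcd s = d) (hpM : ¬p ∣ Module.finrank E K) (hdh : d ∣ h)
    (hl : t.gcd (s / d) = l) (hlu : s / d = l * u)
    (hi : Module.finrank E K / d * i ≡ h / d [MOD s / d]) :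
    ((traceNormSet E γ (0 : F) s h).ncard : ℝ) = (d : ℝ) / s * ((Nat.card F : ℝ) ^ (t - 1) - 1
      - (-1) ^ (n * t) * ((Nat.card F : ℝ) - 1)
        * ((if i ≡ kConst p e n t l [MOD l] then (l : ℝ) else 0) - 1)
        * √((Nat.card F : ℝ) ^ ((t : ℤ) - 2))) := by
  classical
  have hN : l * u ∣ p ^ e + 1 :=
    hlu ▸ (Nat.div_dvd_of_dvd (hd ▸ Nat.gcd_dvd_right _ s)).trans hs
  rw [ncard_traceNormSet_eq hγ (dvd_natCard_units_of_dvd_succ hF hs) hd hdh hi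
      (natCast_ne_zero_of_not_dvd hF hpM), hlu, zero_div,
    tracePowCount_zero_eq hF ht (unitNorm_generates E hγ) hN (hlu ▸ hl), if_pos rfl]
  ring

theorem ncard_traceNormSet_zero_of_coprime (hF : Nat.card F = (p ^ e) ^ (2 * n))
    (ht : Module.finrank F E = t) (hγ : ∀ x, x ∈ Subgroup.zpowers γ) (hs : s ∣ p ^ e + 1)
    (hd : (Module.finrank E K).gcd s = d) (hpM : ¬p ∣ Module.finrank E K) (hdh : d ∣ h)
    (htsd : t.Coprime (s / d)) : ((traceNormSet E γ (0 : F) s h).ncard : ℝ)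
      = (d : ℝ) / s * ((Nat.card F : ℝ) ^ (t - 1) - 1) := by
  obtain ⟨i, hi⟩ := exists_mul_modEq_of_gcd hd (ne_zero_of_dvd_ne_zero (Nat.succ_ne_zero _) hs) h
  rw [ncard_traceNormSet_zero hF ht hγ hs hd hpM hdh htsd (one_mul _).symm hi]
  simp [Nat.modEq_one]

theorem ncard_traceNormSet_of_not_dvd (hF : Nat.card F = (p ^ e) ^ (2 * n))
    (ht : Module.finrank F E = t) (hγ : ∀ x, x ∈ Subgroup.zpowers γ) (hs : s ∣ p ^ e + 1)
    (hd : (Module.finrank E K).gcd s = d) (hpM : ¬p ∣ Module.finrank E K) (hdh : d ∣ h)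
    (hl : t.gcd (s / d) = l) (hlu : s / d = l * u)
    (hi : Module.finrank E K / d * i ≡ h / d [MOD s / d]) {a : F} (ha : a ≠ 0) {ι : ℕ}
    (hι : ((unitNorm E γ ^ ι : Eˣ) : E) = algebraMap F E (-(Module.finrank E K : F) / a))
    (hD : ¬(l : ℤ) ∣ (kConst p e n t (s / d) : ℤ) - i - ι) :
    ((traceNormSet E γ a s h).ncard : ℝ) = (d : ℝ) / s * ((Nat.card F : ℝ) ^ (t - 1)
      - (-1) ^ (n * t) * √((Nat.card F : ℝ) ^ ((t : ℤ) - 2))) := by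
  classical
  have hN : l * u ∣ p ^ e + 1 :=
    hlu ▸ (Nat.div_dvd_of_dvd (hd ▸ Nat.gcd_dvd_right _ s)).trans hs
  have hM := natCast_ne_zero_of_not_dvd hF hpM
  rw [neg_div, ← inv_div] at hι
  rw [ncard_traceNormSet_eq hγ (dvd_natCard_units_of_dvd_succ hF hs) hd hdh hi hM, hlu, if_neg ha,
    sub_zero, tracePowCount_eq_of_not_dvd hF ht (unitNorm_generates E hγ) hN (hlu ▸ hl)
      (div_ne_zero ha hM) hι (hlu ▸ hD)]

theorem ncard_traceNormSet_of_dvd (hF : Nat.card F = (p ^ e) ^ (2 * n))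
    (ht : Module.finrank F E = t) (hγ : ∀ x, x ∈ Subgroup.zpowers γ) (hs : s ∣ p ^ e + 1)
    (hd : (Module.finrank E K).gcd s = d) (hpM : ¬p ∣ Module.finrank E K) (hdh : d ∣ h)
    (hl : t.gcd (s / d) = l) (hlu : s / d = l * u)
    (hi : Module.finrank E K / d * i ≡ h / d [MOD s / d]) {a : F} (ha : a ≠ 0) {ι j : ℕ}
    (hι : ((unitNorm E γ ^ ι : Eˣ) : E) = algebraMap F E (-(Module.finrank E K : F) / a))
    (hD : (l : ℤ) ∣ (kConst p e n t (s / d) : ℤ) - i - ι)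
    (hj : ((Nat.card F ^ t - 1) / (Nat.card F - 1) / l : ℕ) * j
      ≡ ((kConst p e n t (s / d) : ℤ) - i - ι) / l [ZMOD u]) :
    ((traceNormSet E γ a s h).ncard : ℝ) = (d : ℝ) / s * ((Nat.card F : ℝ) ^ (t - 1)
      - (-1) ^ (n * t) * (((-1) ^ n * √(Nat.card F : ℝ)
          * (1 - if j ≡ kConst p e n t u [MOD u] then (u : ℝ) else 0) - 1) * l + 1)
        * √((Nat.card F : ℝ) ^ ((t : ℤ) - 2))) := by
  classical
  have hN : l * u ∣ p ^ e + 1 :=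
    hlu ▸ (Nat.div_dvd_of_dvd (hd ▸ Nat.gcd_dvd_right _ s)).trans hs
  have hM := natCast_ne_zero_of_not_dvd hF hpM
  rw [neg_div, ← inv_div] at hι
  rw [ncard_traceNormSet_eq hγ (dvd_natCard_units_of_dvd_succ hF hs) hd hdh hi hM, hlu, if_neg ha,
    sub_zero, tracePowCount_eq_of_dvd hF ht (unitNorm_generates E hγ) hN (hlu ▸ hl)
      (div_ne_zero ha hM) hι (hlu ▸ hD) (hlu ▸ hj)]

theorem ncard_traceNormSet_of_dvd_finrank (hF : Nat.card F = (p ^ e) ^ (2 * n))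
    (ht : Module.finrank F E = t) (hγ : ∀ x, x ∈ Subgroup.zpowers γ) (hs : s ∣ p ^ e + 1)
    (hsM : s ∣ Module.finrank E K) (hpM : ¬p ∣ Module.finrank E K) (hsh : s ∣ h) {a : F}
    (ha : a ≠ 0) : ((traceNormSet E γ a s h).ncard : ℝ) = (Nat.card F : ℝ) ^ (t - 1) := by
  have hs0 : s ≠ 0 := by rintro rfl; simp at hs
  have hss : s / s = 1 := Nat.div_self (Nat.pos_of_ne_zero hs0)
  have hM : -(Module.finrank E K : F) / a ≠ 0 :=
    div_ne_zero (neg_ne_zero.mpr (natCast_ne_zero_of_not_dvd hF hpM)) ha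
  obtain ⟨ι, hι⟩ := mem_powers_iff_mem_zpowers.mpr
    (unitNorm_generates E hγ (Units.map (algebraMap F E : F →* E) (Units.mk0 _ hM)))
  rw [ncard_traceNormSet_of_dvd (l := 1) (u := 1) (i := 0) (j := 0) hF ht hγ hs
    (Nat.gcd_eq_right hsM) hpM hsh (by simp [hss]) (by simp [hss]) (by simp [hss, Nat.modEq_one]) ha
    (congrArg Units.val hι) (by simp) (by simp [Int.modEq_one])]
  simp [Nat.modEq_one, hs0]

end Values

theorem mainTheorem4 {F K : Type*} [Field F] [Finite F] [Field K] [Finite K] [Algebra F K]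
    (p q r s h m t e n d l u : ℕ)
    -- `F = 𝔽_q`, `q = p ^ r`, `r = 2 e n`
    (hp : p.Prime) (hq : q = p ^ r) (hF : Nat.card F = q) (hr : r = 2 * e * n)
    (hs : s ∣ p ^ e + 1) (hh : h < s)
    -- `K = 𝔽_{q^m}`, `E = 𝔽_{q^t}`
    (hm : 2 ≤ m) (hK : Module.finrank F K = m)
    (E : IntermediateField F K) (hE : Module.finrank F E = t)
    -- `γ` is a primitive element of `K`
    (γ : Kˣ) (hγ : ∀ x : Kˣ, x ∈ Subgroup.zpowers γ)
    (hd : d = Nat.gcd (m / t) s) (hl : l = Nat.gcd t (s / d)) (hu : u = s / (d * l))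
    (hpt : ¬ p ∣ m / t) (hdh : d ∣ h)
    (a : F) :
    -- the table, with `i₀` the solution of `(m / (d t)) i₀ ≡ h / d (mod s / d)` in `[0, s / d)`
    (∀ i₀ : ℕ, i₀ < s / d → m / (d * t) * i₀ ≡ h / d [MOD s / d] →
      (a = 0 →
        ((1 < l ∧ ¬ i₀ ≡ kConst p e n t l [MOD l]) →
          ((traceNormSet E γ a s h).ncard : ℝ) =
            (d : ℝ) / s * ((q : ℝ) ^ (t - 1) - 1
              + (-1) ^ (n * t) * ((q : ℝ) - 1) * √((q : ℝ) ^ ((t : ℤ) - 2)))) ∧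
        ((l = 1 ∨ (1 < l ∧ i₀ ≡ kConst p e n t l [MOD l])) →
          ((traceNormSet E γ a s h).ncard : ℝ) =
            (d : ℝ) / s * ((q : ℝ) ^ (t - 1) - 1
              - (-1) ^ (n * t) * ((q : ℝ) - 1) * ((l : ℝ) - 1)
                  * √((q : ℝ) ^ ((t : ℤ) - 2))))) ∧
      (a ≠ 0 →
        -- `ι` is the index of `a₀ = -m / (t a)` with respect to `γ_t`
        ∀ ι : ℕ, ((unitNorm E γ ^ ι : Eˣ) : E) = algebraMap F E (-((m / t : ℕ) : F) / a) →
          (¬ (l : ℤ) ∣ (kConst p e n t (s / d) : ℤ) - i₀ - ι →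
            ((traceNormSet E γ a s h).ncard : ℝ) =
              (d : ℝ) / s * ((q : ℝ) ^ (t - 1)
                - (-1) ^ (n * t) * √((q : ℝ) ^ ((t : ℤ) - 2)))) ∧
          ((l : ℤ) ∣ (kConst p e n t (s / d) : ℤ) - i₀ - ι →
            -- `j₀` is the solution of `(t₀ / l) j₀ ≡ (k_{s/d} - i₀ - ι) / l (mod u)` in `[0, u)`,
            -- where `t₀ = (q ^ t - 1) / (q - 1)`
            ∀ j₀ : ℕ, j₀ < u →
              (((q ^ t - 1) / (q - 1) / l : ℕ) : ℤ) * j₀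
                ≡ ((kConst p e n t (s / d) : ℤ) - i₀ - ι) / l [ZMOD u] →
              ((1 < u ∧ ¬ j₀ ≡ kConst p e n t u [MOD u]) →
                ((traceNormSet E γ a s h).ncard : ℝ) =
                  (d : ℝ) / s * ((q : ℝ) ^ (t - 1)
                    - (-1) ^ (n * t) * (((-1) ^ n * √(q : ℝ) - 1) * l + 1)
                        * √((q : ℝ) ^ ((t : ℤ) - 2)))) ∧
              ((u = 1 ∨ (1 < u ∧ j₀ ≡ kConst p e n t u [MOD u])) →
                ((traceNormSet E γ a s h).ncard : ℝ) =
                  (d : ℝ) / s * ((q : ℝ) ^ (t - 1)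
                    - (-1) ^ (n * t)
                        * (((-1) ^ (n - 1) * ((u : ℝ) - 1) * √(q : ℝ) - 1) * l + 1)
                        * √((q : ℝ) ^ ((t : ℤ) - 2))))))) ∧
    -- the two special cases
    (a = 0 → l = 1 →
      ((traceNormSet E γ a s h).ncard : ℝ) = (d : ℝ) / s * ((q : ℝ) ^ (t - 1) - 1)) ∧
    (a ≠ 0 → d = s →
      ((traceNormSet E γ a s h).ncard : ℝ) = (q : ℝ) ^ (t - 1)) := by
  have := Fact.mk hp
  have hFP : Nat.card F = (p ^ e) ^ (2 * n) := by
    rw [hF, hq, hr, ← pow_mul, mul_left_comm, mul_assoc]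
  subst hF hK hE
  have hM : Module.finrank F K / Module.finrank F E = Module.finrank E K :=
    Nat.div_eq_of_eq_mul_right Module.finrank_pos (Module.finrank_mul_finrank F E K).symm
  have hlu : s / d = l * u := by
    rw [hu, ← Nat.div_div_eq_div_mul, Nat.mul_div_cancel' (hl ▸ Nat.gcd_dvd_right _ _)]
  rw [mul_comm d, ← Nat.div_div_eq_div_mul]
  rw [hM] at hd hpt ⊢
  refine ⟨fun i₀ _ hi => ⟨?_, fun ha ι hι => ⟨fun hD => ?_, fun hD j₀ _ hj => ?_⟩⟩, ?_, ?_⟩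
  · rintro rfl
    rw [ncard_traceNormSet_zero hFP rfl hγ hs hd.symm hpt hdh hl.symm hlu hi]
    refine ⟨fun hl => ?_, fun hl => ?_⟩
    · rw [if_neg hl.2]
      ring
    · rw [if_pos (hl.elim (fun hl => hl ▸ Nat.modEq_one) And.right)]
  · exact ncard_traceNormSet_of_not_dvd hFP rfl hγ hs hd.symm hpt hdh hl.symm hlu hi ha hι hD
  · rw [ncard_traceNormSet_of_dvd hFP rfl hγ hs hd.symm hpt hdh hl.symm hlu hi ha hι hD hj]
    refine ⟨fun hu => ?_, fun hu => ?_⟩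
    · rw [if_neg hu.2, sub_zero, mul_one]
    · rw [if_pos (hu.elim (fun hu => hu ▸ Nat.modEq_one) And.right)]
      obtain ⟨n, rfl⟩ := Nat.exists_eq_succ_of_ne_zero (ne_zero_of_natCard_eq hFP)
      rw [Nat.succ_sub_one, pow_succ]
      ring
  · rintro rfl hl1
    exact ncard_traceNormSet_zero_of_coprime hFP rfl hγ hs hd.symm hpt hdh (hl.symm.trans hl1)
  · rintro ha rfl
    exact ncard_traceNormSet_of_dvd_finrank hFP rfl hγ hs (hd ▸ Nat.gcd_dvd_left _ _) hpt hdh ha
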